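/- Let $n\ge 1$ and let real numbers $0<\lambda_1<\dots<\lambda_{n-1}$, $b_1,\dots,b_{n-1}<0$ and $M>0$ be given. Set $$\beta_j=\sum_{p=1}^{n-1}\lambda_p^{\,j}b_p,\qquad I_{ij}=\sum_{p=1}^{n-1}\sum_{q=1}^{n-1}\frac{\lambda_p^{\,i}\lambda_q^{\,j}}{\lambda_p+\lambda_q}\,b_pb_q ,$$ and define $k\times k$ determinants as follows. $\mathcal A_k$ is the determinant of $(I_{ij})_{0\le i,j\le k-1}$ with $\frac1{2M}$ added to the entry $I_{00}$. $\mathcal D_k$ is the determinant of $(I_{ij})_{1\le i\le k,\ 0\le j\le k-1}$. For $k\ge1$, $\mathcal D'_k$ is the determinant of the matrix whose first column is $(\beta_0,\dots,\beta_{k-1})^t$ and whose remaining columns are $(I_{1j},\dots,I_{kj})^t$, $0\le j\le k-2$. The empty determinants are $\mathcal A_0=\mathcal D_0=1$. Put $$m_{n-k}=\frac{\mathcal D_k^{\,2}}{2\,\mathcal A_{k+1}\mathcal A_k}\quad(0\le k\le n-1),\qquad l_{n-k}=-\frac{2\mathcal A_k}{\mathcal D'_k}\quad(1\le k\le n-1).$$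 Then all $m_1,\dots,m_n$ and $l_1,\dots,l_{n-1}$ are positive, so there are positions $x_1<\dots<x_n$ with $x_{j+1}-x_j=l_j$ (unique up to a translation). Any such discrete cubic string $\{x_j,m_j\}_{j=1}^n$ has $\{\lambda_k,b_k,M\}$ as its spectral data, in the following sense. For $z\in\mathbf C$ consider the equation $$-\phi'''=z\,m\,\phi\ \text{ on }\mathbf R,\qquad m=2\sum_{j=1}^n m_j\,\delta(x-x_j),$$ meaning that $\phi,\phi'$ are continuous, $\phi'''=0$ off $\{x_1,\dots,x_n\}$, and $\phi''$ jumps by $-2z\,m_j\,\phi(x_j)$ at $x_j$. 1. The eigenvalues $z\in\mathbf C$ of the boundary value problem $\phi'(-\infty)=\phi''(-\infty)=0$, $\phi''(\infty)=0$ are exactly $0,\lambda_1,\dots,\lambda_{n-1}$. 2. The Weyl function $W(z)=\phi'(x_n+)/\phi''(x_n+)$, where $\phi$ is the solution with $\phi=1$ for $x<x_1$, is defined for every $z\in\mathbf C\setminus\{0,\lambda_1,\dots,\lambda_{n-1}\}$ and equals $\sum_{k=1}^{n-1}\frac{b_k}{z-\lambda_k}$ there. 3. $\sum_{j=1}^n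 m_j=M$. -/

import Mathlib

open Filter Topology

noncomputable section

/-- A discrete cubic string with `n` point masses: positions `x_1 < ... < x_n` (indexed from `0`)
and positive masses. The associated measure is `2 * ∑ k, mass k * δ (x - pos k)`. -/
structure DiscreteCubicString (n : ℕ) where
  pos : Fin n → ℝ
  mass : Fin n → ℝ
  pos_strictMono : StrictMono pos
  mass_pos : ∀ k, 0 < mass k

namespace DiscreteCubicString

/-- `φ` solves `-φ''' = z m φ` on the real line, where `m = 2 * ∑ k, mass k * δ (x - pos k)`:
`φ` and `φ'` are continuous, `φ''' = 0` away from the point masses, and `φ''` has one-sided limits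
at each `pos k` with jump `-2 * z * mass k * φ (pos k)`. -/
structure IsSolution {n : ℕ} (S : DiscreteCubicString n) (z : ℂ) (φ : ℝ → ℂ) : Prop where
  contDiff_one : ContDiff ℝ 1 φ
  off_support : ∀ y : ℝ, y ∉ Set.range S.pos → ContDiffAt ℝ 3 φ y ∧ iteratedDeriv 3 φ y = 0
  jump : ∀ k : Fin n, ∃ l r : ℂ,
    Tendsto (iteratedDeriv 2 φ) (𝓝[<] (S.pos k)) (𝓝 l) ∧
    Tendsto (iteratedDeriv 2 φ) (𝓝[>] (S.pos k)) (𝓝 r) ∧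
    r - l = -2 * z * (S.mass k : ℂ) * φ (S.pos k)

/-- `z` is an eigenvalue of the cubic string with the Neumann-like boundary conditions
`φ'(-∞) = φ''(-∞) = 0` and `φ''(∞) = 0`. -/
def IsEigenvalue {n : ℕ} (S : DiscreteCubicString n) (z : ℂ) : Prop :=
  ∃ φ : ℝ → ℂ, φ ≠ 0 ∧ S.IsSolution z φ ∧
    Tendsto (deriv φ) atBot (𝓝 0) ∧
    Tendsto (iteratedDeriv 2 φ) atBot (𝓝 0) ∧
    Tendsto (iteratedDeriv 2 φ) atTop (𝓝 0)

/-- The (first) Weyl function `W(z) = φ'(x_n +) / φ''(x_n +)` is defined at `z` and has the value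
`w` there, where `φ` is the wave function, i.e. the solution with `φ = 1` to the left of `x_1`. -/
def HasWeylValue {N : ℕ} (S : DiscreteCubicString (N + 1)) (z w : ℂ) : Prop :=
  ∃ (φ : ℝ → ℂ) (B A : ℂ), S.IsSolution z φ ∧ (∀ y : ℝ, y < S.pos 0 → φ y = 1) ∧
    Tendsto (deriv φ) (𝓝[>] (S.pos (Fin.last N))) (𝓝 B) ∧
    Tendsto (iteratedDeriv 2 φ) (𝓝[>] (S.pos (Fin.last N))) (𝓝 A) ∧
    A ≠ 0 ∧ w = B / A

/-- The spectral data of a string with `N + 1` masses are `ev`, `b`, `M`: its eigenvalues are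
exactly `0` and the `N` numbers `ev k`; the residues of its Weyl function at the `ev k` are the
`b k`, i.e. `W(z) = ∑ k, b k / (z - ev k)`; and its total mass is `M`. -/
structure HasSpectralData {N : ℕ} (S : DiscreteCubicString (N + 1))
    (ev b : Fin N → ℝ) (M : ℝ) : Prop where
  eigenvalues : ∀ z : ℂ, S.IsEigenvalue z ↔ z = 0 ∨ ∃ k, z = (ev k : ℂ)
  weyl : ∀ z : ℂ, z ≠ 0 → (∀ k, z ≠ (ev k : ℂ)) →
    S.HasWeylValue z (∑ k, (b k : ℂ) / (z - (ev k : ℂ)))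
  total_mass : ∑ k, S.mass k = M

end DiscreteCubicString

namespace CubicStringInverse

/-- The moment `β_j = ∫ λ ^ j dμ(λ)` of the measure `μ = ∑ k, b k * δ (λ - ev k)`. -/
def moment {N : ℕ} (ev b : Fin N → ℝ) (j : ℕ) : ℝ :=
  ∑ p, ev p ^ j * b p

/-- The bimoment `I_{ij} = ∫∫ κ ^ i * λ ^ j / (κ + λ) dμ(κ) dμ(λ)`. -/
def bimoment {N : ℕ} (ev b : Fin N → ℝ) (i j : ℕ) : ℝ :=
  ∑ p, ∑ q, ev p ^ i * ev q ^ j / (ev p + ev q) * b p * b q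

/-- `A_k`: the `k × k` determinant of `I_{ij}`, `0 ≤ i, j < k`, with `1 / (2M)` added to the
upper left entry. -/
def detA {N : ℕ} (ev b : Fin N → ℝ) (M : ℝ) (k : ℕ) : ℝ :=
  (Matrix.of fun i j : Fin k =>
    bimoment ev b i j + if (i : ℕ) = 0 ∧ (j : ℕ) = 0 then 1 / (2 * M) else 0).det

/-- `D_k`: the `k × k` determinant of `I_{ij}`, `1 ≤ i ≤ k`, `0 ≤ j < k`. -/
def detD {N : ℕ} (ev b : Fin N → ℝ) (k : ℕ) : ℝ :=
  (Matrix.of fun i j : Fin k => bimoment ev b (i + 1) j).det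

/-- `D'_k`: the `k × k` determinant with first column `β_0, ..., β_{k-1}`, followed by the columns
`I_{1j}, ..., I_{kj}`, `0 ≤ j ≤ k - 2`. -/
def detD' {N : ℕ} (ev b : Fin N → ℝ) (k : ℕ) : ℝ :=
  (Matrix.of fun i j : Fin k =>
    match (j : ℕ) with
    | 0 => moment ev b i
    | l + 1 => bimoment ev b (i + 1) l).det

/-- The value of `m_{n-k}`, for `0 ≤ k ≤ n - 1`. -/
def massFormula {N : ℕ} (ev b : Fin N → ℝ) (M : ℝ) (k : ℕ) : ℝ :=
  detD ev b k ^ 2 / (2 * detA ev b M (k + 1) * detA ev b M k)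

/-- The value of `l_{n-k}`, for `1 ≤ k ≤ n - 1`. -/
def lengthFormula {N : ℕ} (ev b : Fin N → ℝ) (M : ℝ) (k : ℕ) : ℝ :=
  -(2 * detA ev b M k) / detD' ev b k

/-- The string `S` with `n = N + 1` masses is given by the determinantal formulas.
With indices starting at `0`, `m_{n-k}` is `S.mass (N - k)`, and
`l_{n-k} = x_{n-k+1} - x_{n-k}` is `S.pos (N - k + 1) - S.pos (N - k)`. -/
def IsGivenByFormulas {N : ℕ} (S : DiscreteCubicString (N + 1))
    (ev b : Fin N → ℝ) (M : ℝ) : Prop :=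
  (∀ j : Fin (N + 1), S.mass j = massFormula ev b M (N - j)) ∧
  (∀ j : Fin N, S.pos j.succ - S.pos j.castSucc = lengthFormula ev b M (N - j))

end CubicStringInverse

end

noncomputable section

/-! Write μ = ∑ b_p δ_{λ_p}, β(f) = ∫ f dμ, ⟨f,g⟩ for the bimoment form of μ, and ⟨f,g⟩_M = ⟨f,g⟩ +
f(0)g(0)/(2M). Everything rests on two facts: ⟨·,·⟩_M is positive definite in degree at most N = n -
1, and ⟨Xf,g⟩ + ⟨f,Xg⟩ = β(f)β(g).

The string is read from the right. Let A(z) = -2Mz ∏ (1 - z/λ_p) be the expected value of φ''(x_n+).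
Starting from (q,s,R) = (0,0,1), `peel` produces polynomials that `stateA`, `stateB`, `stateC` turn
into rational functions of z, the candidates for φ''(x_{n-k}+)/A, φ'(x_{n-k})/A and φ(x_{n-k})/A. A
`peel` step is the jump of φ'' at a mass followed by Taylor expansion across an interval, run
leftwards. At k = 0 the first two candidates are 1 and ∑ b_p/(z - λ_p).

The polynomials satisfy the orthogonality relations `PeelInvariant`. These pass from k to k + 1
provided that 2m⟨R,R⟩_M = 1 and l β(q) = 2(-1)^k for the new q; Cramer's rule shows that the
determinantal formulas provide exactly this (`extendedForm_self_mul_sq`, `detD'_succ_eq`). At k = N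
there are as many relations as nodes. They force φ(x_1) = 1, φ'(x_1) = 0 and φ'' = 0 left of x_1
(`targetA_mul_stateC`, `stateB_eq_zero`, `stateA_eq_zero`), which are the data of the wave function.
Induction from left to right (`wave_state`) then identifies the candidates with the wave function
everywhere. At x_n this gives the second derivative A and the Weyl function, and continuity in z
covers the poles of the candidates. The total mass is read off from q_{N+1}(0) in two ways.

Positivity: A_k > 0 by positive definiteness, D_k ≠ 0 by Cramer's rule for R, and D'_k < 0 by a
Cauchy–Binet expansion (`detD'_neg`). -/

/-! ### Positivity of the Cauchy kernel and of Cauchy-type determinants -/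

open Finset in
-- With a the new node, 1/(x+y) = 2a/((x+a)(y+a)) + (x-a)(y-a)/((x+a)(y+a)(x+y)). The first term
-- gives a square; the second gives the same form with coefficients `d`, which vanish at the new
-- node, so that induction applies.
theorem cauchy_kernel_pos {ι : Type*} [DecidableEq ι] (x : ι → ℝ) (hx : ∀ i, 0 < x i)
    (hinj : Function.Injective x) (s : Finset ι) : ∀ c : ι → ℝ,
    0 ≤ ∑ p ∈ s, ∑ q ∈ s, c p * c q / (x p + x q) ∧
    ((∃ p ∈ s, c p ≠ 0) → 0 < ∑ p ∈ s, ∑ q ∈ s, c p * c q / (x p + x q)) := by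
  induction s using Finset.induction_on with
  | empty => intro c; simp
  | insert a s ha ih =>
    intro c
    set d : ι → ℝ := fun p => c p * (x p - x a) / (x p + x a) with hd
    have hda : d a = 0 := by simp [hd]
    have key : ∑ p ∈ insert a s, ∑ q ∈ insert a s, c p * c q / (x p + x q) =
        2 * x a * (∑ p ∈ insert a s, c p / (x p + x a)) ^ 2 +
          ∑ p ∈ s, ∑ q ∈ s, d p * d q / (x p + x q) := by
      have h1 : ∑ p ∈ s, ∑ q ∈ s, d p * d q / (x p + x q) =
          ∑ p ∈ insert a s, ∑ q ∈ insert a s, d p * d q / (x p + x q) := by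
        simp [Finset.sum_insert ha, hda]
      rw [h1, pow_two, Finset.sum_mul_sum, Finset.mul_sum, ← Finset.sum_add_distrib]
      refine Finset.sum_congr rfl fun p _ => ?_
      rw [Finset.mul_sum, ← Finset.sum_add_distrib]
      refine Finset.sum_congr rfl fun q _ => ?_
      have := hx p; have := hx q; have := hx a
      simp only [hd]
      field_simp
      ring
    have hxa := hx a
    obtain ⟨h0, h1⟩ := ih d
    rw [key]
    refine ⟨by positivity, ?_⟩
    rintro ⟨p, hp, hcp⟩
    by_cases hs : ∃ p ∈ s, c p ≠ 0
    · obtain ⟨p, hp, hcp⟩ := hs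
      have hne : x p - x a ≠ 0 := fun h => ha (hinj (sub_eq_zero.1 h) ▸ hp)
      have := h1 ⟨p, hp, div_ne_zero (mul_ne_zero hcp hne) (by have := hx p; positivity)⟩
      positivity
    · push Not at hs
      have hca : c a ≠ 0 := by
        rcases Finset.mem_insert.1 hp with rfl | h
        · exact hcp
        · exact absurd (hs p h) hcp
      have : ∑ p ∈ insert a s, c p / (x p + x a) = c a / (x a + x a) := by
        rw [Finset.sum_insert ha, Finset.sum_eq_zero fun p hp => by simp [hs p hp], add_zero]
      rw [this]
      positivity

open Finset in
-- Subtracting (x₀+y₀)/(x_i+y₀) times row 0 from row i clears the first column. What remains is a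
-- smaller Cauchy matrix with its rows and columns rescaled.
theorem det_cauchy : ∀ {n : ℕ} (x y : Fin n → ℝ), (∀ i, 0 < x i) → (∀ i, 0 < y i) →
    (Matrix.of fun i j => 1 / (x i + y j)).det * ∏ i, ∏ j, (x i + y j) =
      (Matrix.vandermonde x).det * (Matrix.vandermonde y).det
  | 0, x, y, _, _ => by simp
  | n + 1, x, y, hx, hy => by
    have ih := det_cauchy (fun i => x i.succ) (fun i => y i.succ) (fun i => hx _) (fun i => hy _)
    have hpos : ∀ i j, x i + y j ≠ 0 := fun i j => (add_pos (hx i) (hy j)).ne'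
    have h1 : (Matrix.of fun i j => 1 / (x i + y j)).det =
        (Matrix.of fun i j => Fin.cases (1 / (x 0 + y j))
          (fun i => (x i.succ - x 0) * (y j - y 0) /
            ((x i.succ + y 0) * (x 0 + y j) * (x i.succ + y j))) i).det := by
      refine Matrix.det_eq_of_forall_row_eq_smul_add_const
        (Fin.cases 0 fun i => (x 0 + y 0) / (x i.succ + y 0)) 0 (by simp) fun i j => ?_
      refine Fin.cases ?_ (fun i => ?_) i
      · simp
      · simp only [Matrix.of_apply, Fin.cases_succ, Fin.cases_zero]
        have := hpos 0 0; have := hpos 0 j; have := hpos i.succ 0; have := hpos i.succ j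
        field_simp
        ring
    have h2 : (Matrix.of fun i j : Fin n => (x i.succ - x 0) * (y j.succ - y 0) /
            ((x i.succ + y 0) * (x 0 + y j.succ) * (x i.succ + y j.succ))).det =
        (∏ i : Fin n, (x i.succ - x 0) / (x i.succ + y 0)) *
        ((∏ j : Fin n, (y j.succ - y 0) / (x 0 + y j.succ)) *
          (Matrix.of fun i j : Fin n => 1 / (x i.succ + y j.succ)).det) := by
      rw [← Matrix.det_mul_row, ← Matrix.det_mul_column]
      congr 1
      ext i j
      simp only [Matrix.of_apply]
      have := hpos 0 j.succ; have := hpos i.succ 0; have := hpos i.succ j.succ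
      field_simp
    rw [h1, Matrix.det_succ_column_zero, Fin.sum_univ_succ]
    have h3 : ∀ i : Fin n, (Matrix.of fun i j : Fin (n + 1) => Fin.cases (motive := fun _ => ℝ)
        (1 / (x 0 + y j)) (fun i => (x i.succ - x 0) * (y j - y 0) /
            ((x i.succ + y 0) * (x 0 + y j) * (x i.succ + y j))) i) i.succ 0 = 0 := by
      intro i; simp
    simp only [h3, mul_zero, zero_mul, Finset.sum_const_zero, add_zero]
    have h4 : ((Matrix.of fun i j : Fin (n + 1) => Fin.cases (motive := fun _ => ℝ)
        (1 / (x 0 + y j)) (fun i => (x i.succ - x 0) * (y j - y 0) /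
            ((x i.succ + y 0) * (x 0 + y j) * (x i.succ + y j))) i).submatrix
            (Fin.succAbove 0) Fin.succ) = (Matrix.of fun i j : Fin n =>
            (x i.succ - x 0) * (y j.succ - y 0) /
            ((x i.succ + y 0) * (x 0 + y j.succ) * (x i.succ + y j.succ))) := by
      ext i j; simp
    rw [h4, h2]
    simp only [Matrix.det_vandermonde] at ih ⊢
    rw [Fin.prod_univ_succ (fun i => ∏ j ∈ Ioi i, (x j - x i)),
      Fin.prod_univ_succ (fun i => ∏ j ∈ Ioi i, (y j - y i))]
    simp only [Fin.prod_Ioi_zero, Fin.prod_Ioi_succ, Fin.prod_univ_succ (fun i => ∏ j, (x i + y j))]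
    simp only [Fin.prod_univ_succ (fun j => x _ + y j), Finset.prod_mul_distrib,
      Finset.prod_div_distrib]
    have e1 : ∏ i : Fin n, (x i.succ + y 0) ≠ 0 := Finset.prod_ne_zero_iff.2 fun i _ => hpos _ _
    have e2 : ∏ i : Fin n, (x 0 + y i.succ) ≠ 0 := Finset.prod_ne_zero_iff.2 fun i _ => hpos _ _
    have e3 := hpos 0 0
    simp only [Fin.val_zero, pow_zero, one_mul, Matrix.of_apply, Fin.cases_zero]
    generalize (∏ i : Fin n, (x i.succ + y 0)) = X at *
    generalize (∏ i : Fin n, (x 0 + y i.succ)) = Y at *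
    field_simp
    linear_combination (∏ i : Fin n, (x i.succ - x 0)) * (∏ i : Fin n, (y i.succ - y 0)) * ih

/-- A form of the Cauchy–Binet formula with sums over all maps. -/
theorem factorial_mul_det_mul {k : ℕ} {ι : Type*} [Fintype ι]
    (A : Matrix (Fin k) ι ℝ) (B : Matrix ι (Fin k) ℝ) :
    (k.factorial : ℝ) * (A * B).det =
      ∑ f : Fin k → ι, (A.submatrix id f).det * (B.submatrix f id).det := by
  classical
  have h1 : (A * B).det = ∑ f : Fin k → ι, (∏ i, A i (f i)) * (B.submatrix f id).det := by
    have := (Matrix.detRowAlternating (n := Fin k) (R := ℝ)).toMultilinearMap.map_sum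
      (fun i p => A i p • B p)
    have e : (A * B) = fun i => ∑ p, A i p • B p := by
      ext i j; simp [Matrix.mul_apply, Finset.sum_apply]
    calc (A * B).det = Matrix.detRowAlternating (fun i => ∑ p, A i p • B p) := by rw [e]; rfl
      _ = _ := this
      _ = _ := by
        refine Finset.sum_congr rfl fun f _ => ?_
        exact (Matrix.detRowAlternating (n := Fin k) (R := ℝ)).toMultilinearMap.map_smul_univ
          (fun i => A i (f i)) (fun i => B (f i))
  -- Reindexing f by σ changes the minor of B by sign σ; summing over all σ then assembles the minor
  -- of A.
  have h2 : ∀ σ : Equiv.Perm (Fin k), (A * B).det =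
      ∑ f : Fin k → ι, (Equiv.Perm.sign σ : ℝ) * (∏ i, A i (f (σ i))) * (B.submatrix f id).det := by
    intro σ
    rw [h1, ← (Equiv.arrowCongr σ.symm (Equiv.refl ι)).sum_comp]
    refine Finset.sum_congr rfl fun f _ => ?_
    have : (B.submatrix (f ∘ σ) id).det = (Equiv.Perm.sign σ : ℝ) * (B.submatrix f id).det := by
      rw [← Matrix.det_permute]; rfl
    have e : Equiv.arrowCongr σ.symm (Equiv.refl ι) f = f ∘ σ := rfl
    rw [e, this]
    simp only [Function.comp_apply]
    ring
  have h3 : (k.factorial : ℝ) * (A * B).det = ∑ σ : Equiv.Perm (Fin k), (A * B).det := by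
    simp [Fintype.card_perm]
  rw [h3, Finset.sum_congr rfl fun σ _ => h2 σ, Finset.sum_comm]
  refine Finset.sum_congr rfl fun f _ => ?_
  rw [← Finset.sum_mul]
  congr 1
  rw [← Matrix.det_transpose, Matrix.det_apply']
  rfl

/-- By Cauchy–Binet and `det_cauchy`, m! times the product is a sum over maps f of squares of two
Vandermonde determinants times positive factors. The term of an injective f is positive once x is
injective too. -/
theorem det_mul_vandermonde_sign {N m : ℕ} (ev w : Fin N → ℝ) (hev : ∀ k, 0 < ev k)
    (hw : ∀ k, 0 < w k) (x : Fin m → ℝ) (hx : ∀ i, 0 < x i) :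
    0 ≤ (Matrix.vandermonde x).det *
      (Matrix.of fun i j : Fin m => ∑ q, 1 / (x i + ev q) * (w q * ev q ^ (j : ℕ))).det ∧
    (Function.Injective x → Function.Injective ev → m ≤ N → 0 < (Matrix.vandermonde x).det *
      (Matrix.of fun i j : Fin m => ∑ q, 1 / (x i + ev q) * (w q * ev q ^ (j : ℕ))).det) := by
  have hfac : (0 : ℝ) < m.factorial := by exact_mod_cast m.factorial_pos
  have key : (m.factorial : ℝ) * ((Matrix.vandermonde x).det *
      (Matrix.of fun i j : Fin m => ∑ q, 1 / (x i + ev q) * (w q * ev q ^ (j : ℕ))).det) =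
      ∑ f : Fin m → Fin N, (Matrix.vandermonde x).det ^ 2 *
        (Matrix.vandermonde fun i => ev (f i)).det ^ 2 * (∏ i, w (f i)) /
          ∏ i, ∏ j, (x i + ev (f j)) := by
    have e : (Matrix.of fun i j : Fin m => ∑ q, 1 / (x i + ev q) * (w q * ev q ^ (j : ℕ))) =
        (Matrix.of fun (i : Fin m) q => 1 / (x i + ev q)) *
          (Matrix.of fun q (j : Fin m) => w q * ev q ^ (j : ℕ)) := by
      ext i j; simp [Matrix.mul_apply]
    rw [mul_left_comm, e, factorial_mul_det_mul, Finset.mul_sum]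
    refine Finset.sum_congr rfl fun f _ => ?_
    have h1 := det_cauchy x (fun i => ev (f i)) hx (fun i => hev _)
    have h2 : ((Matrix.of fun q (j : Fin m) => w q * ev q ^ (j : ℕ)).submatrix f id).det =
        (∏ i, w (f i)) * (Matrix.vandermonde fun i => ev (f i)).det := by
      rw [← Matrix.det_mul_column]; rfl
    have h3 : ((Matrix.of fun (i : Fin m) q => 1 / (x i + ev q)).submatrix id f) =
      (Matrix.of fun i j => 1 / (x i + ev (f j))) := rfl
    have h4 : ∏ i, ∏ j, (x i + ev (f j)) ≠ 0 := Finset.prod_ne_zero_iff.2 fun i _ =>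
      Finset.prod_ne_zero_iff.2 fun j _ => (add_pos (hx _) (hev _)).ne'
    rw [h2, h3, eq_div_iff h4]
    linear_combination (Matrix.vandermonde x).det *
      (Matrix.vandermonde fun i => ev (f i)).det * (∏ i, w (f i)) * h1
  have hterm : ∀ f : Fin m → Fin N, 0 ≤ (Matrix.vandermonde x).det ^ 2 *
        (Matrix.vandermonde fun i => ev (f i)).det ^ 2 * (∏ i, w (f i)) /
          ∏ i, ∏ j, (x i + ev (f j)) := fun f =>
    div_nonneg (mul_nonneg (by positivity) (Finset.prod_nonneg fun i _ => (hw _).le))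
      (Finset.prod_nonneg fun i _ => Finset.prod_nonneg fun j _ => (add_pos (hx _) (hev _)).le)
  refine ⟨?_, fun hxi hi hmN => ?_⟩
  · refine nonneg_of_mul_nonneg_right (a := (m.factorial : ℝ)) ?_ hfac
    rw [key]
    exact Finset.sum_nonneg fun f _ => hterm f
  · refine pos_of_mul_pos_right (a := (m.factorial : ℝ)) ?_ hfac.le
    rw [key]
    refine Finset.sum_pos' (fun f _ => hterm f) ⟨Fin.castLE hmN, Finset.mem_univ _, ?_⟩
    have v1 := Matrix.det_vandermonde_ne_zero_iff.2 hxi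
    have v2 := Matrix.det_vandermonde_ne_zero_iff.2
      (hi.comp (Fin.castLE_injective hmN) : Function.Injective fun i => ev (Fin.castLE hmN i))
    exact div_pos (mul_pos (by positivity) (Finset.prod_pos fun i _ => hw _))
      (Finset.prod_pos fun i _ => Finset.prod_pos fun j _ => add_pos (hx _) (hev _))

/-- Subtract row 0 from the others: x_i/(x_i+ξ) - x₀/(x₀+ξ) = (x_i-x₀)ξ/((x_i+ξ)(x₀+ξ)). The factor
ξ/(x₀+ξ) is absorbed into the weight, which stays positive when w is. -/
theorem det_bordered_cauchy {N m : ℕ} (ev w : Fin N → ℝ) (hev : ∀ k, 0 < ev k)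
    (x : Fin (m + 1) → ℝ) (hx : ∀ i, 0 < x i) :
    (Matrix.of fun i j : Fin (m + 1) => Fin.cases (motive := fun _ => ℝ) 1
      (fun l : Fin m => ∑ q, x i / (x i + ev q) * (w q * ev q ^ (l : ℕ))) j).det =
    (∏ i : Fin m, (x i.succ - x 0)) * (Matrix.of fun i j : Fin m =>
      ∑ q, 1 / (x i.succ + ev q) * (w q * ev q / (x 0 + ev q) * ev q ^ (j : ℕ))).det := by
  rw [← Matrix.det_mul_column, Matrix.det_eq_of_forall_row_eq_smul_add_const
    (B := Matrix.of fun i j : Fin (m + 1) => Fin.cases (motive := fun _ => ℝ)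
      (Fin.cases (motive := fun _ => ℝ) 1
        (fun l : Fin m => ∑ q, x 0 / (x 0 + ev q) * (w q * ev q ^ (l : ℕ))) j)
      (fun i => Fin.cases (motive := fun _ => ℝ) 0 (fun l : Fin m => (x i.succ - x 0) *
        ∑ q, 1 / (x i.succ + ev q) * (w q * ev q / (x 0 + ev q) * ev q ^ (l : ℕ))) j) i)
    (Fin.cases 0 fun _ => 1) 0 (by simp), Matrix.det_succ_column_zero, Fin.sum_univ_succ,
    Finset.sum_eq_zero]
  · simp only [Fin.val_zero, pow_zero, one_mul, Matrix.of_apply, Fin.cases_zero, add_zero]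
    congr 1
  · intro i _; simp
  · intro i j
    refine Fin.cases ?_ (fun i => ?_) i
    · simp
    · refine Fin.cases ?_ (fun j => ?_) j
      · simp
      · simp only [Matrix.of_apply, Fin.cases_succ, Fin.cases_zero, one_mul]
        rw [Finset.mul_sum, ← Finset.sum_add_distrib]
        refine Finset.sum_congr rfl fun q _ => ?_
        have := hx i.succ; have := hx 0; have := hev q
        field_simp
        ring

/-- Replacing b by c = -b flips only the column of moments, since bimoments are quadratic in b. The
resulting matrix factors through the nodes as a weighted Vandermonde times a bordered Cauchy matrix.
In each Cauchy–Binet term the factors λ_{f(i+1)} - λ_{f(0)} occur squared, and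
`det_mul_vandermonde_sign` handles the rest. -/
theorem CubicStringInverse.detD'_neg {N m : ℕ} (ev b : Fin N → ℝ) (hev : ∀ k, 0 < ev k)
    (hinj : Function.Injective ev) (hb : ∀ k, b k < 0) (hm : m + 1 ≤ N) :
    CubicStringInverse.detD' ev b (m + 1) < 0 := by
  set c : Fin N → ℝ := fun p => - b p with hc
  have hcpos : ∀ p, 0 < c p := fun p => neg_pos.2 (hb p)
  set G : Matrix (Fin (m + 1)) (Fin (m + 1)) ℝ := Matrix.of fun i j =>
    ∑ p, c p * ev p ^ (i : ℕ) * Fin.cases (motive := fun _ => ℝ) 1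
      (fun l : Fin m => ∑ q, ev p / (ev p + ev q) * (c q * ev q ^ (l : ℕ))) j with hG
  have h1 : CubicStringInverse.detD' ev b (m + 1) = - G.det := by
    have e : CubicStringInverse.detD' ev b (m + 1) = (Matrix.of fun i j : Fin (m + 1) =>
        Fin.cases (motive := fun _ => ℝ) (-1) (fun _ => 1) j * G i j).det := by
      unfold CubicStringInverse.detD'
      congr 1
      ext i j
      refine Fin.cases ?_ (fun j => ?_) j
      · simp [hG, hc, CubicStringInverse.moment, mul_comm]
      · simp only [hG, hc, CubicStringInverse.bimoment, Matrix.of_apply, Fin.val_succ,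
          Fin.cases_succ, one_mul]
        refine Finset.sum_congr rfl fun p _ => ?_
        rw [Finset.mul_sum]
        refine Finset.sum_congr rfl fun q _ => ?_
        ring
    rw [e, Matrix.det_mul_row, Fin.prod_univ_succ]
    simp
  rw [h1, neg_lt_zero]
  have e : G = (Matrix.of fun (i : Fin (m + 1)) p => c p * ev p ^ (i : ℕ)) *
      (Matrix.of fun p (j : Fin (m + 1)) => Fin.cases (motive := fun _ => ℝ) 1
      (fun l : Fin m => ∑ q, ev p / (ev p + ev q) * (c q * ev q ^ (l : ℕ))) j) := by
    ext i j; simp [hG, Matrix.mul_apply]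
  refine pos_of_mul_pos_right (a := ((m + 1).factorial : ℝ)) ?_ (by positivity)
  rw [e, factorial_mul_det_mul]
  have hV : ∀ x : Fin (m + 1) → ℝ, (Matrix.vandermonde x).det =
      (∏ i : Fin m, (x i.succ - x 0)) * (Matrix.vandermonde fun i => x i.succ).det := by
    intro x
    rw [Matrix.det_vandermonde, Matrix.det_vandermonde, Fin.prod_univ_succ]
    simp only [Fin.prod_Ioi_zero, Fin.prod_Ioi_succ]
  have hterm : ∀ f : Fin (m + 1) → Fin N,
      ((Matrix.of fun (i : Fin (m + 1)) p => c p * ev p ^ (i : ℕ)).submatrix id f).det *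
      ((Matrix.of fun p (j : Fin (m + 1)) => Fin.cases (motive := fun _ => ℝ) 1
      (fun l : Fin m => ∑ q, ev p / (ev p + ev q) * (c q * ev q ^ (l : ℕ))) j).submatrix f id).det
      = (∏ i, c (f i)) * (∏ i : Fin m, (ev (f i.succ) - ev (f 0))) ^ 2 *
        ((Matrix.vandermonde fun i : Fin m => ev (f i.succ)).det * (Matrix.of fun i j : Fin m =>
      ∑ q, 1 / (ev (f i.succ) + ev q) *
        (c q * ev q / (ev (f 0) + ev q) * ev q ^ (j : ℕ))).det) := by
    intro f
    have h2 : ((Matrix.of fun (i : Fin (m + 1)) p => c p * ev p ^ (i : ℕ)).submatrix id f).det =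
        (∏ i, c (f i)) * (Matrix.vandermonde fun i => ev (f i)).det := by
      rw [← Matrix.det_transpose, ← Matrix.det_mul_column]; rfl
    have h3 := det_bordered_cauchy ev c hev (fun i => ev (f i)) (fun i => hev _)
    have h4 : ((Matrix.of fun p (j : Fin (m + 1)) => Fin.cases (motive := fun _ => ℝ) 1
      (fun l : Fin m => ∑ q, ev p / (ev p + ev q) * (c q * ev q ^ (l : ℕ))) j).submatrix f id) =
      (Matrix.of fun i j : Fin (m + 1) => Fin.cases (motive := fun _ => ℝ) 1
      (fun l : Fin m => ∑ q, ev (f i) / (ev (f i) + ev q) * (c q * ev q ^ (l : ℕ))) j) := rfl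
    rw [h2, h4, h3, hV]
    ring
  have hw : ∀ f : Fin (m + 1) → Fin N, ∀ q, 0 < c q * ev q / (ev (f 0) + ev q) := fun f q =>
    div_pos (mul_pos (hcpos _) (hev _)) (add_pos (hev _) (hev _))
  have hs := fun f : Fin (m + 1) → Fin N => det_mul_vandermonde_sign ev _ hev (hw f)
    (fun i => ev (f i.succ)) (fun i => hev _)
  refine Finset.sum_pos' (fun f _ => ?_) ⟨Fin.castLE hm, Finset.mem_univ _, ?_⟩
  · rw [hterm]
    exact mul_nonneg (mul_nonneg (Finset.prod_nonneg fun i _ => (hcpos _).le) (sq_nonneg _))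
      (hs f).1
  · rw [hterm]
    have hi := hinj.comp (Fin.castLE_injective hm)
    refine mul_pos (mul_pos (Finset.prod_pos fun i _ => hcpos _) (sq_pos_of_ne_zero ?_))
      ((hs _).2 (hi.comp (Fin.succ_injective _)) hinj (by omega))
    refine Finset.prod_ne_zero_iff.2 fun i _ => sub_ne_zero.2 fun h => ?_
    exact Fin.succ_ne_zero i (hi h)

/-! ### The moment functional, the bimoment form and its extension by a mass at 0 -/

namespace CubicStringInverse
open Polynomial

variable {N : ℕ}

/-- The moment functional of the measure `∑ k, b k * δ (λ - ev k)`. -/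
def momentMap (ev b : Fin N → ℝ) : ℝ[X] →ₗ[ℝ] ℝ where
  toFun f := ∑ p, f.eval (ev p) * b p
  map_add' f g := by simp [add_mul, Finset.sum_add_distrib]
  map_smul' c f := by simp [Finset.mul_sum, mul_assoc]

/-- The bimoment form `∫∫ f κ * g λ / (κ + λ) dμ(κ) dμ(λ)`. -/
def bimomentForm (ev b : Fin N → ℝ) : ℝ[X] →ₗ[ℝ] ℝ[X] →ₗ[ℝ] ℝ :=
  LinearMap.mk₂ ℝ
    (fun f g => ∑ p, ∑ q, f.eval (ev p) * g.eval (ev q) / (ev p + ev q) * b p * b q)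
    (fun f g h => by
      simp only [eval_add, ← Finset.sum_add_distrib]
      exact Finset.sum_congr rfl fun p _ => Finset.sum_congr rfl fun q _ => by ring)
    (fun c f g => by
      simp only [eval_smul, smul_eq_mul, Finset.mul_sum]
      exact Finset.sum_congr rfl fun p _ => Finset.sum_congr rfl fun q _ => by ring)
    (fun f g h => by
      simp only [eval_add, ← Finset.sum_add_distrib]
      exact Finset.sum_congr rfl fun p _ => Finset.sum_congr rfl fun q _ => by ring)
    (fun c f g => by
      simp only [eval_smul, smul_eq_mul, Finset.mul_sum]
      exact Finset.sum_congr rfl fun p _ => Finset.sum_congr rfl fun q _ => by ring)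

/-- The bimoment form of the measure extended by a point mass at the origin. -/
def extendedForm (ev b : Fin N → ℝ) (M : ℝ) : ℝ[X] →ₗ[ℝ] ℝ[X] →ₗ[ℝ] ℝ :=
  bimomentForm ev b + (1 / (2 * M)) • (LinearMap.mul ℝ ℝ).compl₁₂ (leval 0) (leval 0)

theorem momentMap_apply (ev b : Fin N → ℝ) (f : ℝ[X]) :
    momentMap ev b f = ∑ p, f.eval (ev p) * b p := rfl

theorem bimomentForm_apply (ev b : Fin N → ℝ) (f g : ℝ[X]) : bimomentForm ev b f g =
    ∑ p, ∑ q, f.eval (ev p) * g.eval (ev q) / (ev p + ev q) * b p * b q := rfl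

theorem extendedForm_apply (ev b : Fin N → ℝ) (M : ℝ) (f g : ℝ[X]) : extendedForm ev b M f g =
    bimomentForm ev b f g + f.eval 0 * g.eval 0 / (2 * M) := by
  simp [extendedForm, leval]
  ring

theorem bimomentForm_comm (ev b : Fin N → ℝ) (f g : ℝ[X]) :
    bimomentForm ev b f g = bimomentForm ev b g f := by
  rw [bimomentForm_apply, bimomentForm_apply, Finset.sum_comm]
  refine Finset.sum_congr rfl fun p _ => Finset.sum_congr rfl fun q _ => ?_
  rw [add_comm (ev p)]
  ring

theorem extendedForm_comm (ev b : Fin N → ℝ) (M : ℝ) (f g : ℝ[X]) :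
    extendedForm ev b M f g = extendedForm ev b M g f := by
  rw [extendedForm_apply, extendedForm_apply, bimomentForm_comm, mul_comm (eval 0 f)]

theorem extendedForm_X_mul (ev b : Fin N → ℝ) (M : ℝ) (f g : ℝ[X]) :
    extendedForm ev b M f (X * g) = bimomentForm ev b f (X * g) := by
  simp [extendedForm_apply]

/-- The factor κ + λ cancels the denominator, so the double integral splits. -/
theorem bimomentForm_X_mul_add {ev b : Fin N → ℝ} (hev : ∀ k, 0 < ev k) (f g : ℝ[X]) :
    bimomentForm ev b (X * f) g + bimomentForm ev b f (X * g) =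
      momentMap ev b f * momentMap ev b g := by
  simp only [bimomentForm_apply, momentMap_apply, Finset.sum_mul_sum, ← Finset.sum_add_distrib]
  refine Finset.sum_congr rfl fun p _ => Finset.sum_congr rfl fun q _ => ?_
  have := hev p; have := hev q
  simp only [eval_mul, eval_X]
  field_simp

theorem bimomentForm_X_mul_self {ev b : Fin N → ℝ} (hev : ∀ k, 0 < ev k) (f : ℝ[X]) :
    bimomentForm ev b (X * f) f = momentMap ev b f ^ 2 / 2 := by
  have := bimomentForm_X_mul_add (b := b) hev f f
  rw [bimomentForm_comm ev b f] at this
  linarith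

theorem moment_eq (ev b : Fin N → ℝ) (j : ℕ) : moment ev b j = momentMap ev b (X ^ j) := by
  simp [moment, momentMap_apply]

theorem bimoment_eq (ev b : Fin N → ℝ) (i j : ℕ) :
    bimoment ev b i j = bimomentForm ev b (X ^ i) (X ^ j) := by
  simp [bimoment, bimomentForm_apply]

theorem extendedForm_X_pow (ev b : Fin N → ℝ) (M : ℝ) (i j : ℕ) :
    extendedForm ev b M (X ^ i) (X ^ j) =
      bimoment ev b i j + if i = 0 ∧ j = 0 then 1 / (2 * M) else 0 := by
  rw [extendedForm_apply, bimoment_eq]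
  congr 1
  rcases Nat.eq_zero_or_pos i with rfl | hi
  · rcases Nat.eq_zero_or_pos j with rfl | hj
    · simp
    · simp [hj.ne']
  · simp [hi.ne']

theorem detA_eq (ev b : Fin N → ℝ) (M : ℝ) (k : ℕ) : detA ev b M k =
    (Matrix.of fun i j : Fin k => extendedForm ev b M (X ^ (i : ℕ)) (X ^ (j : ℕ))).det := by
  simp only [extendedForm_X_pow, detA]

theorem extendedForm_pos {ev b : Fin N → ℝ} {M : ℝ} (hev : ∀ k, 0 < ev k)
    (hinj : Function.Injective ev) (hb : ∀ k, b k < 0) (hM : 0 < M) {f : ℝ[X]} (hf : f ≠ 0)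
    (hdeg : f.degree < (N + 1 : ℕ)) : 0 < extendedForm ev b M f f := by
  obtain ⟨h0, h1⟩ := cauchy_kernel_pos ev hev hinj Finset.univ fun p => f.eval (ev p) * b p
  have e : bimomentForm ev b f f = ∑ p, ∑ q,
      (f.eval (ev p) * b p) * (f.eval (ev q) * b q) / (ev p + ev q) := by
    rw [bimomentForm_apply]
    exact Finset.sum_congr rfl fun p _ => Finset.sum_congr rfl fun q _ => by ring
  rw [extendedForm_apply, e]
  by_cases hp : ∃ p, f.eval (ev p) ≠ 0
  · obtain ⟨p, hp⟩ := hp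
    refine add_pos_of_pos_of_nonneg (h1 ⟨p, Finset.mem_univ _, mul_ne_zero hp (hb p).ne⟩) ?_
    have := mul_self_nonneg (f.eval 0)
    positivity
  · push Not at hp
    have h00 : f.eval 0 ≠ 0 := by
      intro h00
      -- The mass at 0 contributes one more node: f would vanish at the N + 1 distinct points 0,
      -- λ_1, ..., λ_N, with degree at most N.
      refine hf (Polynomial.eq_zero_of_degree_lt_of_eval_index_eq_zero Finset.univ
        (v := (Fin.cons 0 ev : Fin (N + 1) → ℝ)) (Function.Injective.injOn ?_) (by simpa using hdeg) ?_)
      · rw [Fin.cons_injective_iff]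
        exact ⟨fun ⟨p, hp⟩ => (hev p).ne' hp, hinj⟩
      · intro i _
        refine Fin.cases ?_ (fun i => ?_) i
        · simpa using h00
        · simpa using hp i
    have := mul_self_pos.2 h00
    positivity

theorem eq_sum_fin_of_degree_lt {k : ℕ} {f : ℝ[X]} (hf : f.degree < (k : ℕ)) :
    f = ∑ i : Fin k, f.coeff i • X ^ (i : ℕ) := by
  rcases eq_or_ne f 0 with rfl | h
  · simp
  · conv_lhs => rw [f.as_sum_range' k ((natDegree_lt_iff_degree_lt h).2 hf)]
    rw [Finset.sum_range]
    exact Finset.sum_congr rfl fun i _ => by rw [smul_X_eq_monomial]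

theorem sum_fin_ne_zero {k : ℕ} {v : Fin k → ℝ} (hv : v ≠ 0) :
    (∑ i, v i • X ^ (i : ℕ) : ℝ[X]) ≠ 0 := by
  intro h
  refine hv (funext fun i => ?_)
  have := congrArg (fun f : ℝ[X] => f.coeff i) h
  simpa [finsetSum_coeff, coeff_X_pow, ← Fin.ext_iff] using this

theorem degree_sum_fin_smul_lt {k : ℕ} (v : Fin k → ℝ) :
    (∑ i, v i • X ^ (i : ℕ) : ℝ[X]).degree < (k : ℕ) := by
  simp only [smul_eq_C_mul]
  exact degree_sum_fin_lt v

theorem detA_pos {ev b : Fin N → ℝ} {M : ℝ} (hev : ∀ k, 0 < ev k)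
    (hinj : Function.Injective ev) (hb : ∀ k, b k < 0) (hM : 0 < M) {k : ℕ} (hk : k ≤ N + 1) :
    0 < detA ev b M k := by
  rw [detA_eq]
  refine Matrix.PosDef.det_pos (Matrix.PosDef.of_dotProduct_mulVec_pos ?_ fun v hv => ?_)
  · ext i j
    simp [extendedForm_comm ev b M (X ^ (i : ℕ))]
  · have := extendedForm_pos hev hinj hb hM (sum_fin_ne_zero hv)
      ((degree_sum_fin_smul_lt v).trans_le (by exact_mod_cast hk))
    simp only [map_sum, map_smul, LinearMap.sum_apply, LinearMap.smul_apply, smul_eq_mul,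
      Finset.mul_sum] at this
    rw [Finset.sum_comm] at this
    simpa [Matrix.mulVec, Finset.mul_sum, mul_comm, mul_left_comm, dotProduct] using this

/-! ### Cramer's rule: determinants in terms of orthogonal polynomials -/

/-- The Gram matrix sends the coefficient vector r of R to h e_k. Cramer's rule for the first and
last coefficients gives A_{k+1} = ±D_k h and A_{k+1} r_k = A_k h, while the form at (R, R) equals
r_k h. The normalisation R(0) = 1 is what makes D_k nonzero. -/
theorem extendedForm_self_mul_sq {ev b : Fin N → ℝ} {M : ℝ} {k : ℕ} {R : ℝ[X]}
    (hA : 0 < detA ev b M (k + 1)) (hdeg : R.degree < (k + 1 : ℕ)) (hR0 : R.eval 0 = 1)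
    (horth : ∀ f : ℝ[X], f.degree < (k : ℕ) → extendedForm ev b M f R = 0) :
    detD ev b k ≠ 0 ∧
      extendedForm ev b M R R * detD ev b k ^ 2 = detA ev b M (k + 1) * detA ev b M k := by
  set G : Matrix (Fin (k + 1)) (Fin (k + 1)) ℝ :=
    Matrix.of fun i j => extendedForm ev b M (X ^ (i : ℕ)) (X ^ (j : ℕ)) with hG
  set r : Fin (k + 1) → ℝ := fun i => R.coeff i with hr
  set h := extendedForm ev b M (X ^ k) R with hh
  have hform : ∀ f, extendedForm ev b M f R = ∑ j, r j * extendedForm ev b M f (X ^ (j : ℕ)) := by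
    intro f
    conv_lhs => rw [eq_sum_fin_of_degree_lt hdeg]
    simp [hr]
  have hGr : G.mulVec r = Pi.single (Fin.last k) h := by
    ext i
    have : G.mulVec r i = extendedForm ev b M (X ^ (i : ℕ)) R := by
      rw [hform]
      simp [hG, Matrix.mulVec, dotProduct, mul_comm]
    rw [this]
    refine Fin.lastCases ?_ (fun i => ?_) i
    · simp [hh]
    · rw [Pi.single_eq_of_ne (Fin.castSucc_lt_last i).ne]
      refine horth _ ?_
      rw [degree_X_pow]
      exact_mod_cast i.2
  have hadj : ∀ i, detA ev b M (k + 1) * r i = G.adjugate i (Fin.last k) * h := by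
    intro i
    have h1 : G.adjugate.mulVec (G.mulVec r) = G.det • r := by
      rw [Matrix.mulVec_mulVec, Matrix.adjugate_mul, Matrix.smul_mulVec, Matrix.one_mulVec]
    rw [hGr] at h1
    have := congrFun h1 i
    rw [Matrix.mulVec_single] at this
    rw [detA_eq]
    simpa [mul_comm] using this.symm
  have h0 := hadj 0
  have hl := hadj (Fin.last k)
  have a0 : G.adjugate 0 (Fin.last k) = (-1) ^ k * detD ev b k := by
    rw [Matrix.adjugate_fin_succ_eq_det_submatrix, detD, ← Matrix.det_transpose]
    simp only [Fin.val_last, Fin.val_zero, add_zero]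
    congr 2
    ext i j
    simp [hG, extendedForm_X_pow, bimoment_eq]
    rw [bimomentForm_comm]
  have al : G.adjugate (Fin.last k) (Fin.last k) = detA ev b M k := by
    rw [Matrix.adjugate_fin_succ_eq_det_submatrix, detA_eq]
    simp only [Fin.val_last, ← two_mul, pow_mul, neg_one_sq, one_pow, one_mul]
    congr 1
    ext i j
    simp [hG]
  have hr0 : r 0 = 1 := by rw [← hR0, hr]; simp [coeff_zero_eq_eval_zero]
  have hRR : extendedForm ev b M R R = r (Fin.last k) * h := by
    have : extendedForm ev b M R R = dotProduct r (G.mulVec r) := by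
      rw [hform]
      refine Finset.sum_congr rfl fun j _ => ?_
      rw [extendedForm_comm, hform]
      simp [hG, Matrix.mulVec, dotProduct, mul_comm]
    rw [this, hGr]
    simp
  rw [hr0, a0, mul_one] at h0
  rw [al] at hl
  refine ⟨fun hD => ?_, ?_⟩
  · rw [hD] at h0; simp at h0; exact hA.ne' h0
  · rw [hRR]
    have hs : ((-1 : ℝ) ^ k) ^ 2 = 1 := by rw [← pow_mul, mul_comm, pow_mul]; simp
    have h2 : (r (Fin.last k) * h * detD ev b k ^ 2) * detA ev b M (k + 1) =
      (detA ev b M (k + 1) * detA ev b M k) * detA ev b M (k + 1) := by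
      have : detA ev b M (k + 1) ^ 2 = detD ev b k ^ 2 * h ^ 2 := by
        conv_lhs => rw [h0]
        linear_combination detD ev b k ^ 2 * h ^ 2 * hs
      linear_combination h * detD ev b k ^ 2 * hl - detA ev b M k * this
    exact mul_right_cancel₀ hA.ne' h2

/-- The Gram matrix G sends the coefficients of q to -e_0, so A_{m+1} β(q) is minus the determinant
of G with row 0 replaced by the moments. The relation I_{i+1,j} + I_{i,j+1} = β_i β_j turns that
matrix into the one defining D'. -/
theorem detD'_succ_eq {ev b : Fin N → ℝ} (hev : ∀ k, 0 < ev k) {M : ℝ} {m : ℕ} {q : ℝ[X]}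
    (hdeg : q.degree < (m + 1 : ℕ))
    (hq : ∀ f : ℝ[X], f.degree < (m + 1 : ℕ) → extendedForm ev b M f q = -f.eval 0) :
    detD' ev b (m + 1) = (-1) ^ (m + 1) * detA ev b M (m + 1) * momentMap ev b q := by
  set G : Matrix (Fin (m + 1)) (Fin (m + 1)) ℝ :=
    Matrix.of fun i j => extendedForm ev b M (X ^ (i : ℕ)) (X ^ (j : ℕ)) with hG
  set β : Fin (m + 1) → ℝ := fun j => moment ev b j with hβ
  set r : Fin (m + 1) → ℝ := fun i => q.coeff i with hr
  have hGr : G.mulVec r = Pi.single 0 (-1) := by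
    ext i
    have : G.mulVec r i = extendedForm ev b M (X ^ (i : ℕ)) q := by
      conv_rhs => rw [eq_sum_fin_of_degree_lt hdeg]
      simp [hG, hr, Matrix.mulVec, dotProduct, mul_comm]
    rw [this, hq _ (by rw [degree_X_pow]; exact_mod_cast i.2)]
    refine Fin.cases ?_ (fun i => ?_) i
    · simp
    · simp
  have h1 : detA ev b M (m + 1) * momentMap ev b q = - (G.updateRow 0 β).det := by
    have e1 : detA ev b M (m + 1) • r = G.adjugate.mulVec (Pi.single 0 (-1)) := by
      rw [← hGr, Matrix.mulVec_mulVec, Matrix.adjugate_mul, Matrix.smul_mulVec, Matrix.one_mulVec,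
        detA_eq]
    have e2 : (G.updateRow 0 β).det = ∑ j, β j * G.adjugate j 0 := by
      rw [← Matrix.cramer_transpose_apply, Matrix.cramer_eq_adjugate_mulVec,
        ← Matrix.adjugate_transpose]
      simp [Matrix.mulVec, dotProduct, mul_comm]
    have e3 : momentMap ev b q = ∑ j, r j * β j := by
      conv_lhs => rw [eq_sum_fin_of_degree_lt hdeg]
      simp [hr, hβ, moment_eq]
    rw [e2, e3, Finset.mul_sum, ← Finset.sum_neg_distrib]
    refine Finset.sum_congr rfl fun j _ => ?_
    have := congrFun e1 j
    simp only [Pi.smul_apply, smul_eq_mul, Matrix.mulVec_single] at this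
    rw [← mul_assoc, this]
    simp
    ring
  have h2 : detD' ev b (m + 1) = (-1) ^ m * (G.updateRow 0 β).det := by
    have e1 : (-1) ^ m * (G.updateRow 0 β).det = (Matrix.of fun i j =>
        (Fin.cases (motive := fun _ => ℝ) 1 (fun _ => -1) i : ℝ) * G.updateRow 0 β i j).det := by
      rw [Matrix.det_mul_column, Fin.prod_univ_succ]
      simp
    rw [e1, detD', ← Matrix.det_transpose]
    -- I_{j+1,l} = β_l β_j - I_{j,l+1}: up to sign, row l + 1 differs from that of G by β_l times
    -- the row of moments.
    refine Matrix.det_eq_of_forall_row_eq_smul_add_const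
      (Fin.cases 0 fun l => moment ev b l) 0 (by simp) fun i j => ?_
    refine Fin.cases ?_ (fun l => ?_) i
    · simp [hβ]
    · have := bimomentForm_X_mul_add (b := b) hev (X ^ (l : ℕ)) (X ^ (j : ℕ))
      have e2 : bimoment ev b (j + 1) l = bimomentForm ev b (X ^ (l : ℕ)) (X * X ^ (j : ℕ)) := by
        rw [bimoment_eq, bimomentForm_comm, pow_succ']
      have e3 : G l.succ j = bimomentForm ev b (X * X ^ (l : ℕ)) (X ^ (j : ℕ)) := by
        simp [hG, extendedForm_X_pow, bimoment_eq, pow_succ']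
      simp only [Matrix.transpose_apply, Matrix.of_apply, Fin.val_succ, Fin.cases_succ,
        Matrix.updateRow_self, Matrix.updateRow_ne (Fin.succ_ne_zero l), Fin.cases_zero, hβ,
        one_mul]
      rw [e2, e3, moment_eq, moment_eq]
      linarith
  rw [h2, pow_succ]
  linear_combination (-1) ^ m * h1

/-! ### The peeling recursion and its orthogonality relations -/

theorem degree_X_mul_lt {k : ℕ} {f : ℝ[X]} (hf : f.degree < (k : ℕ)) :
    (X * f : ℝ[X]).degree < (k + 1 : ℕ) := by
  rw [degree_lt_iff_coeff_zero] at hf ⊢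
  intro m hm
  obtain ⟨m, rfl⟩ : ∃ m', m = m' + 1 := ⟨m - 1, by omega⟩
  rw [coeff_X_mul]
  exact hf m (by omega)

theorem degree_lt_of_coeff_eq_zero {k : ℕ} {f : ℝ[X]} (hf : f.degree < (k + 1 : ℕ))
    (h : f.coeff k = 0) : f.degree < (k : ℕ) := by
  rw [degree_lt_iff_coeff_zero] at hf ⊢
  intro m hm
  rcases hm.eq_or_lt with rfl | hm
  · exact h
  · exact hf m hm

theorem degree_lt_succ {k : ℕ} {f : ℝ[X]} (hf : f.degree < (k : ℕ)) : f.degree < (k + 1 : ℕ) :=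
  hf.trans (by exact_mod_cast k.lt_succ_self)

theorem degree_add_smul_lt {k : ℕ} {f g : ℝ[X]} (c : ℝ) (hf : f.degree < (k : ℕ))
    (hg : g.degree < (k : ℕ)) : (f + c • g).degree < (k : ℕ) :=
  mem_degreeLT.1 (Submodule.add_mem _ (mem_degreeLT.2 hf)
    (Submodule.smul_mem _ c (mem_degreeLT.2 hg)))

/-- A functional vanishing in degrees below `k` and at one polynomial of degree `k` vanishes on
all polynomials of degree at most `k`. -/
theorem eq_zero_of_degree_lt_succ {k : ℕ} {L : ℝ[X] →ₗ[ℝ] ℝ}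
    (hL : ∀ f : ℝ[X], f.degree < (k : ℕ) → L f = 0) {g : ℝ[X]} (hg : g.degree < (k + 1 : ℕ))
    (hgk : g.coeff k ≠ 0) (hLg : L g = 0) (f : ℝ[X]) (hf : f.degree < (k + 1 : ℕ)) : L f = 0 := by
  have h := hL (f + (-(f.coeff k / g.coeff k)) • g)
    (degree_lt_of_coeff_eq_zero (degree_add_smul_lt _ hf hg) (by simp [hgk]))
  simpa [hLg] using h

/-- The polynomials `q`, `s`, `R` which describe the second derivative, the first derivative and
the value of the wave function after `k` masses and intervals have been removed from the right. -/
structure PeelInvariant (ev b : Fin N → ℝ) (M : ℝ) (k : ℕ) (q s R : ℝ[X]) : Prop where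
  q_degree : q.degree < (k : ℕ)
  s_degree : s.degree < (k : ℕ)
  R_degree : R.degree < (k + 1 : ℕ)
  R_zero : R.eval 0 = 1
  q_orth : ∀ f : ℝ[X], f.degree < (k : ℕ) → extendedForm ev b M f q = -f.eval 0
  s_orth : ∀ f : ℝ[X], f.degree < (k : ℕ) → bimomentForm ev b (X * f) s = momentMap ev b f
  R_orth : ∀ f : ℝ[X], f.degree < (k : ℕ) → extendedForm ev b M f R = 0
  s_moment : momentMap ev b s = 1 - (-1) ^ k

theorem peelInvariant_zero (ev b : Fin N → ℝ) (M : ℝ) : PeelInvariant ev b M 0 0 0 1 := by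
  have h : ∀ f : ℝ[X], f.degree < ((0 : ℕ) : WithBot ℕ) → f = 0 := fun f hf =>
    Polynomial.ext fun n => by
      rw [coeff_zero]; exact (degree_lt_iff_coeff_zero f 0).1 hf n (Nat.zero_le _)
  constructor
  · simp
  · simp
  · simp
  · simp
  · intro f hf; simp [h f hf]
  · intro f hf; simp [h f hf]
  · intro f hf; simp [h f hf]
  · simp

section
variable {ev b : Fin N → ℝ} {M : ℝ} (hev : ∀ k, 0 < ev k) (hinj : Function.Injective ev)
  (hb : ∀ k, b k < 0) (hM : 0 < M) {k : ℕ} {q s R : ℝ[X]}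
include hev hinj hb hM

theorem PeelInvariant.two_mul_massFormula (h : PeelInvariant ev b M k q s R) (hk : k ≤ N) :
    0 < massFormula ev b M k ∧ 2 * massFormula ev b M k * extendedForm ev b M R R = 1 := by
  have hA := detA_pos hev hinj hb hM (show k ≤ N + 1 by omega)
  have hA' := detA_pos hev hinj hb hM (show k + 1 ≤ N + 1 by omega)
  obtain ⟨hD, hR⟩ := extendedForm_self_mul_sq hA' h.R_degree h.R_zero h.R_orth
  unfold massFormula
  refine ⟨by positivity, ?_⟩
  field_simp
  linarith

/-- In lower degree R would be orthogonal to itself. -/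
theorem PeelInvariant.R_coeff_ne_zero (h : PeelInvariant ev b M k q s R) (hk : k ≤ N) :
    R.coeff k ≠ 0 := by
  intro h0
  have h1 := h.R_orth R (degree_lt_of_coeff_eq_zero h.R_degree h0)
  have h2 := (h.two_mul_massFormula hev hinj hb hM hk).2
  rw [h1, mul_zero] at h2
  exact zero_ne_one h2

/-- Subtracting 2mR changes nothing against degree below k, since R is orthogonal there. Against R
itself, q contributes 0 and -2m⟨R,R⟩_M = -1 = -R(0). -/
theorem PeelInvariant.q_succ (h : PeelInvariant ev b M k q s R) (hk : k ≤ N) :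
    (q + (-(2 * massFormula ev b M k)) • R).degree < (k + 1 : ℕ) ∧
    (q + (-(2 * massFormula ev b M k)) • R).coeff k ≠ 0 ∧
    ∀ f : ℝ[X], f.degree < (k + 1 : ℕ) →
      extendedForm ev b M f (q + (-(2 * massFormula ev b M k)) • R) = -f.eval 0 := by
  obtain ⟨hm, hmR⟩ := h.two_mul_massFormula hev hinj hb hM hk
  have hRk := h.R_coeff_ne_zero hev hinj hb hM hk
  refine ⟨degree_add_smul_lt _ (degree_lt_succ h.q_degree) h.R_degree, ?_, ?_⟩
  · have : q.coeff k = 0 := (degree_lt_iff_coeff_zero q k).1 h.q_degree k le_rfl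
    simp [this, hm.ne', hRk]
  · have key := eq_zero_of_degree_lt_succ (k := k) (L := (extendedForm ev b M).flip
      (q + (-(2 * massFormula ev b M k)) • R) + leval 0) (fun f hf => by
        simp [leval, h.q_orth f hf, h.R_orth f hf]) h.R_degree hRk (by
        rw [LinearMap.add_apply, LinearMap.flip_apply, map_add, map_smul,
          extendedForm_comm ev b M R q]
        have h1 : extendedForm ev b M q R = 0 := h.R_orth q h.q_degree
        simp only [h1, leval_apply, h.R_zero, smul_eq_mul]
        linarith)
    intro f hf
    have := key f hf
    rw [LinearMap.add_apply, LinearMap.flip_apply, leval_apply] at this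
    linarith

/-- This is the only property of the lengths that the recursion needs; A_{k+1} cancels between the
formula for l and `detD'_succ_eq`. -/
theorem lengthFormula_mul_momentMap (hk : k + 1 ≤ N) (hdeg : q.degree < (k + 1 : ℕ))
    (hq : ∀ f : ℝ[X], f.degree < (k + 1 : ℕ) → extendedForm ev b M f q = -f.eval 0) :
    lengthFormula ev b M (k + 1) * momentMap ev b q = 2 * (-1) ^ k := by
  have hA := detA_pos hev hinj hb hM (show k + 1 ≤ N + 1 by omega)
  have hD := detD'_neg ev b hev hinj hb hk
  have h1 := detD'_succ_eq hev hdeg hq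
  unfold lengthFormula
  have hs : ((-1 : ℝ) ^ k) * (-1) ^ k = 1 := by rw [← mul_pow]; simp
  rw [div_mul_eq_mul_div, div_eq_iff hD.ne, h1, pow_succ]
  linear_combination (-2 * detA ev b M (k + 1) * momentMap ev b q) * hs.symm

theorem lengthFormula_pos (hk : k + 1 ≤ N) : 0 < lengthFormula ev b M (k + 1) := by
  have hA := detA_pos hev hinj hb hM (show k + 1 ≤ N + 1 by omega)
  exact div_pos_of_neg_of_neg (by linarith) (detD'_neg ev b hev hinj hb hk)

/-- Since q' has degree exactly k, each new relation need only be checked in degree below k and at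
q' itself. There q' is orthogonal to multiples of X, and ⟨Xq',q'⟩ = β(q')²/2. -/
theorem PeelInvariant.succ (h : PeelInvariant ev b M k q s R) (hk : k + 1 ≤ N) {q' s' R' : ℝ[X]}
    (hq' : q' = q + (-(2 * massFormula ev b M k)) • R)
    (hs' : s' = s + lengthFormula ev b M (k + 1) • q')
    (hR' : R' = R + lengthFormula ev b M (k + 1) • (X * s) +
      (lengthFormula ev b M (k + 1) ^ 2 / 2) • (X * q')) :
    PeelInvariant ev b M (k + 1) q' s' R' := by
  obtain ⟨hdeg, hcoeff, horth⟩ := h.q_succ hev hinj hb hM (show k ≤ N by omega)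
  rw [← hq'] at hdeg hcoeff horth
  have hl := lengthFormula_mul_momentMap hev hinj hb hM hk hdeg horth
  set l := lengthFormula ev b M (k + 1)
  have hsq : ((-1 : ℝ) ^ k) * (-1) ^ k = 1 := by rw [← mul_pow]; simp
  have hXq : ∀ f : ℝ[X], f.degree < (k : ℕ) → bimomentForm ev b (X * f) q' = 0 := fun f hf => by
    have := horth _ (degree_X_mul_lt hf)
    rw [extendedForm_comm, extendedForm_X_mul, bimomentForm_comm] at this
    simpa using this
  have hqXq := bimomentForm_X_mul_self (b := b) hev q'
  have hqXs : bimomentForm ev b q' (X * s) = 0 := by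
    have := horth _ (degree_X_mul_lt h.s_degree)
    rw [extendedForm_comm, extendedForm_X_mul] at this
    simpa using this
  refine ⟨hdeg, ?_, ?_, ?_, horth, ?_, ?_, ?_⟩
  · rw [hs']; exact degree_add_smul_lt _ (degree_lt_succ h.s_degree) hdeg
  · rw [hR']
    exact degree_add_smul_lt _ (degree_add_smul_lt _ (degree_lt_succ h.R_degree)
      (degree_lt_succ (degree_X_mul_lt h.s_degree))) (degree_X_mul_lt hdeg)
  · rw [hR']; simp [h.R_zero]
  -- At q': ⟨Xq',s⟩ = β(q')(1 - (-1)^k) because ⟨q',Xs⟩ = 0, and l⟨Xq',q'⟩ = (-1)^k β(q').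
  · have key := eq_zero_of_degree_lt_succ (k := k)
      (L := (bimomentForm ev b).flip s' ∘ₗ LinearMap.mulLeft ℝ X - momentMap ev b)
      (fun f hf => by simp [hs', h.s_orth f hf, hXq f hf]) hdeg hcoeff (by
        simp only [LinearMap.sub_apply, LinearMap.comp_apply, LinearMap.flip_apply,
          LinearMap.mulLeft_apply, hs', map_add, map_smul,
          LinearMap.add_apply, LinearMap.smul_apply, smul_eq_mul, hqXq]
        have := bimomentForm_X_mul_add (b := b) hev q' s
        rw [hqXs, h.s_moment] at this
        linear_combination this + momentMap ev b q' / 2 * hl)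
    intro f hf
    have := key f hf
    simp only [LinearMap.sub_apply, LinearMap.comp_apply, LinearMap.flip_apply,
          LinearMap.mulLeft_apply] at this
    linarith
  -- In degree below k the two corrections contribute ∓ l(-1)^k β(f) and cancel. At q' the old R
  -- gives -R(0) = -1 and the last correction gives l²β(q')²/4 = 1.
  · refine eq_zero_of_degree_lt_succ (k := k) (L := (extendedForm ev b M).flip R')
      (fun f hf => ?_) hdeg hcoeff ?_
    · simp only [LinearMap.flip_apply, hR', map_add, map_smul,
        LinearMap.add_apply, LinearMap.smul_apply, smul_eq_mul, h.R_orth f hf,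
        extendedForm_X_mul]
      have h1 := bimomentForm_X_mul_add (b := b) hev f s
      have h2 := bimomentForm_X_mul_add (b := b) hev f q'
      rw [hXq f hf] at h2
      rw [h.s_orth f hf, h.s_moment] at h1
      linear_combination l * h1 + l ^ 2 / 2 * h2 + l * momentMap ev b f / 2 * hl
    · simp only [LinearMap.flip_apply, hR', map_add, map_smul,
        LinearMap.add_apply, LinearMap.smul_apply, smul_eq_mul,
        extendedForm_X_mul, hqXs]
      rw [extendedForm_comm, horth R h.R_degree, h.R_zero, bimomentForm_comm, hqXq]
      linear_combination (l * momentMap ev b q' + 2 * (-1) ^ k) / 4 * hl + hsq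
  · rw [hs', map_add, map_smul, smul_eq_mul, hl, h.s_moment, pow_succ]
    ring

end

/-- The triples `(q, s, R)` obtained by removing masses `m k` and intervals `l k`. -/
def peel (m l : ℕ → ℝ) : ℕ → ℝ[X] × ℝ[X] × ℝ[X]
  | 0 => (0, 0, 1)
  | k + 1 =>
    let q := (peel m l k).1 + (-(2 * m k)) • (peel m l k).2.2
    (q, (peel m l k).2.1 + l k • q,
      (peel m l k).2.2 + l k • (X * (peel m l k).2.1) + (l k ^ 2 / 2) • (X * q))

/-- The triples for the masses and lengths given by the determinantal formulas. -/
def peelFormula (ev b : Fin N → ℝ) (M : ℝ) : ℕ → ℝ[X] × ℝ[X] × ℝ[X] :=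
  peel (massFormula ev b M) fun k => lengthFormula ev b M (k + 1)

theorem peelInvariant_peelFormula {ev b : Fin N → ℝ} {M : ℝ} (hev : ∀ k, 0 < ev k)
    (hinj : Function.Injective ev) (hb : ∀ k, b k < 0) (hM : 0 < M) : ∀ {k : ℕ}, k ≤ N →
    PeelInvariant ev b M k (peelFormula ev b M k).1 (peelFormula ev b M k).2.1
      (peelFormula ev b M k).2.2
  | 0, _ => peelInvariant_zero ev b M
  | _ + 1, hk => (peelInvariant_peelFormula hev hinj hb hM (Nat.le_of_succ_le hk)).succ hev hinj
      hb hM hk rfl rfl rfl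

/-! ### From polynomials to candidate values of the wave function -/

/-- The Cauchy transform `∫ f λ / (ev p + λ) dμ(λ)`. -/
def cauchyTransform (ev b : Fin N → ℝ) (f : ℝ[X]) (p : Fin N) : ℝ :=
  ∑ q, f.eval (ev q) * b q / (ev p + ev q)

theorem cauchyTransform_add_smul (ev b : Fin N → ℝ) (f g : ℝ[X]) (c : ℝ) (p : Fin N) :
    cauchyTransform ev b (f + c • g) p = cauchyTransform ev b f p + c * cauchyTransform ev b g p := by
  simp only [cauchyTransform, Finset.mul_sum, ← Finset.sum_add_distrib]
  refine Finset.sum_congr rfl fun q _ => ?_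
  simp only [eval_add, eval_smul, smul_eq_mul]
  ring

theorem cauchyTransform_X_mul {ev : Fin N → ℝ} (b : Fin N → ℝ) (hev : ∀ k, 0 < ev k) (f : ℝ[X])
    (p : Fin N) :
    cauchyTransform ev b (X * f) p = momentMap ev b f - ev p * cauchyTransform ev b f p := by
  simp only [cauchyTransform, momentMap_apply, Finset.mul_sum, ← Finset.sum_sub_distrib]
  refine Finset.sum_congr rfl fun q _ => ?_
  have := hev p; have := hev q
  simp only [eval_mul, eval_X]
  field_simp
  ring

theorem bimomentForm_eq_sum (ev b : Fin N → ℝ) (f g : ℝ[X]) :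
    bimomentForm ev b f g = ∑ p, f.eval (ev p) * (b p * cauchyTransform ev b g p) := by
  rw [bimomentForm_apply]
  refine Finset.sum_congr rfl fun p _ => ?_
  simp only [cauchyTransform, Finset.mul_sum]
  refine Finset.sum_congr rfl fun q _ => ?_
  ring

/-- The value of the wave function, relative to its final second derivative. -/
def stateC (ev b : Fin N → ℝ) (M : ℝ) (z : ℂ) (R : ℝ[X]) : ℂ :=
  -1 / (2 * M * z) - ∑ p, (b p : ℂ) * cauchyTransform ev b R p / (z - ev p)

/-- The derivative of the wave function, relative to its final second derivative. -/
def stateB (ev b : Fin N → ℝ) (z : ℂ) (s : ℝ[X]) : ℂ :=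
  ∑ p, (b p : ℂ) * (1 - ev p * cauchyTransform ev b s p) / (z - ev p)

/-- The second derivative of the wave function, relative to its final value. -/
def stateA (ev b : Fin N → ℝ) (M : ℝ) (z : ℂ) (q : ℝ[X]) : ℂ :=
  ∑ p, (b p : ℂ) * (ev p * cauchyTransform ev b q p) / (z - ev p) +
    ((1 + extendedForm ev b M 1 q : ℝ) : ℂ)

/-- The jump of φ'' at a mass. Expanding z/(z-λ) = 1 + λ/(z-λ) in z·`stateC` leaves the constant
-⟨1,R⟩_M, whose part 1/(2M) comes from R(0) = 1; this is why `stateA` carries the constant 1 +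
⟨1,q⟩_M. -/
theorem stateA_sub_smul {ev b : Fin N → ℝ} {M : ℝ} {z : ℂ} (hz : z ≠ 0)
    (hz' : ∀ k, z ≠ ev k) (q : ℝ[X]) {R : ℝ[X]} (hR : R.eval 0 = 1) (m : ℝ) :
    stateA ev b M z (q + (-(2 * m)) • R) =
      stateA ev b M z q + 2 * z * m * stateC ev b M z R := by
  have h1 : z * stateC ev b M z R = -(∑ p, (b p : ℂ) * (ev p * cauchyTransform ev b R p) /
      (z - ev p)) - ((extendedForm ev b M 1 R : ℝ) : ℂ) := by
    have e : ((extendedForm ev b M 1 R : ℝ) : ℂ) = (∑ p, (b p : ℂ) * cauchyTransform ev b R p) +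
        1 / (2 * M) := by
      rw [extendedForm_apply, bimomentForm_eq_sum, hR]
      push_cast
      simp
    have e2 : z * ∑ p, (b p : ℂ) * cauchyTransform ev b R p / (z - ev p) =
        (∑ p, (b p : ℂ) * (ev p * cauchyTransform ev b R p) / (z - ev p)) +
        ∑ p, (b p : ℂ) * cauchyTransform ev b R p := by
      rw [Finset.mul_sum, ← Finset.sum_add_distrib]
      refine Finset.sum_congr rfl fun p _ => ?_
      have := sub_ne_zero.2 (hz' p)
      field_simp
      ring
    have e3 : z * (-1 / (2 * M * z)) = -(1 / (2 * M)) := by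
      rw [mul_comm (2 * (M : ℂ)) z, ← div_div, ← mul_div_assoc, mul_div_cancel₀ _ hz, neg_div]
    rw [stateC, mul_sub, e2, e3, e]
    ring
  have h2 : stateA ev b M z (q + (-(2 * m)) • R) = stateA ev b M z q - 2 * m *
      ((∑ p, (b p : ℂ) * (ev p * cauchyTransform ev b R p) / (z - ev p)) +
        ((extendedForm ev b M 1 R : ℝ) : ℂ)) := by
    simp only [stateA, cauchyTransform_add_smul, map_add, map_smul, smul_eq_mul]
    push_cast
    rw [mul_add, Finset.mul_sum, sub_eq_add_neg, neg_add, ← Finset.sum_neg_distrib]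
    have : ∀ a b c d e : ℂ, a = b + d → a + (1 + (c + -(2 * ↑m) * e)) =
      b + (1 + c) + (d + -(2 * ↑m * e)) := by intros; subst_vars; ring
    apply this
    rw [← Finset.sum_add_distrib]
    exact Finset.sum_congr rfl fun p _ => by ring
  rw [h2]
  linear_combination (-2 * (m : ℂ)) * h1

theorem stateB_add_smul (ev b : Fin N → ℝ) {M : ℝ} (z : ℂ) (s : ℝ[X]) {q : ℝ[X]}
    (hq : extendedForm ev b M 1 q = -1) (l : ℝ) :
    stateB ev b z (s + l • q) = stateB ev b z s - l * stateA ev b M z q := by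
  simp only [stateA, hq, stateB, add_neg_cancel, Complex.ofReal_zero, add_zero, Finset.mul_sum,
    ← Finset.sum_sub_distrib, cauchyTransform_add_smul]
  refine Finset.sum_congr rfl fun p _ => ?_
  push_cast
  ring

/-- Taylor expansion over an interval of length l. The Cauchy transform turns X into a moment minus
λ_p times the transform; `hl` makes the moments add up to the 1 in `stateB`. -/
theorem stateC_add_smul {ev b : Fin N → ℝ} (hev : ∀ k, 0 < ev k) {M : ℝ} (z : ℂ) (R s : ℝ[X])
    {q : ℝ[X]} (hq : extendedForm ev b M 1 q = -1) {l : ℝ}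
    (hl : l * momentMap ev b s + l ^ 2 / 2 * momentMap ev b q = l) :
    stateC ev b M z (R + l • (X * s) + (l ^ 2 / 2) • (X * q)) =
      stateC ev b M z R - l * stateB ev b z s + l ^ 2 / 2 * stateA ev b M z q := by
  simp only [stateA, hq, stateB, stateC, add_neg_cancel, Complex.ofReal_zero, add_zero,
    Finset.mul_sum, cauchyTransform_add_smul, cauchyTransform_X_mul b hev]
  rw [sub_sub, sub_add, sub_right_inj, ← Finset.sum_add_distrib, ← Finset.sum_sub_distrib]
  refine Finset.sum_congr rfl fun p _ => ?_
  have hl' : (l : ℂ) * (momentMap ev b s : ℝ) + l ^ 2 / 2 * (momentMap ev b q : ℝ) = l := by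
    exact_mod_cast congrArg (fun x : ℝ => (x : ℂ)) hl
  push_cast
  linear_combination (b p : ℂ) / (z - ev p) * hl'

/-- Test against the polynomial interpolating w, which gives ∑ w_p² = 0. -/
theorem eq_zero_of_sum_eval_mul {ev : Fin N → ℝ} (hinj : Function.Injective ev) {w : Fin N → ℝ}
    (h : ∀ f : ℝ[X], f.degree < (N : ℕ) → ∑ p, f.eval (ev p) * w p = 0) (p : Fin N) :
    w p = 0 := by
  have h1 := h (Lagrange.interpolate Finset.univ ev w)
    (by simpa using Lagrange.degree_interpolate_lt (s := Finset.univ) w hinj.injOn)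
  have h2 : ∑ p, w p * w p = 0 := by
    rw [← h1]
    refine Finset.sum_congr rfl fun p _ => ?_
    rw [Lagrange.eval_interpolate_at_node _ hinj.injOn (Finset.mem_univ p)]
  exact mul_self_eq_zero.1
    ((Finset.sum_eq_zero_iff_of_nonneg fun p _ => mul_self_nonneg (w p)).1 h2 p (Finset.mem_univ p))

theorem stateB_eq_zero {ev b : Fin N → ℝ} (hinj : Function.Injective ev) {s : ℝ[X]}
    (hs : ∀ f : ℝ[X], f.degree < (N : ℕ) → bimomentForm ev b (X * f) s = momentMap ev b f)
    (z : ℂ) : stateB ev b z s = 0 := by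
  have h := eq_zero_of_sum_eval_mul hinj (w := fun p => b p * (1 - ev p * cauchyTransform ev b s p))
    fun f hf => by
      have := hs f hf
      rw [bimomentForm_eq_sum, momentMap_apply] at this
      simp only [eval_mul, eval_X] at this
      rw [← sub_eq_zero.2 this.symm, ← Finset.sum_sub_distrib]
      exact Finset.sum_congr rfl fun p _ => by ring
  refine Finset.sum_eq_zero fun p _ => ?_
  have := h p
  have h' : (b p : ℂ) * (1 - ev p * cauchyTransform ev b s p) = 0 := by exact_mod_cast this
  rw [h', zero_div]

/-- Testing against multiples of X kills every residue; testing against 1 kills the constant. -/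
theorem stateA_eq_zero {ev b : Fin N → ℝ} (hinj : Function.Injective ev) {M : ℝ} {q : ℝ[X]}
    (hq : ∀ f : ℝ[X], f.degree < (N + 1 : ℕ) → extendedForm ev b M f q = -f.eval 0)
    (z : ℂ) : stateA ev b M z q = 0 := by
  have h := eq_zero_of_sum_eval_mul hinj (w := fun p => b p * (ev p * cauchyTransform ev b q p))
    fun f hf => by
      have := hq _ (degree_X_mul_lt hf)
      rw [extendedForm_apply, bimomentForm_eq_sum] at this
      simp only [eval_mul, eval_X, zero_mul, neg_zero, zero_div, add_zero] at this
      rw [← this]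
      exact Finset.sum_congr rfl fun p _ => by ring
  have h1 := hq 1 (by rw [degree_one]; exact_mod_cast N.succ_pos)
  rw [stateA, h1, Finset.sum_eq_zero]
  · simp
  · intro p _
    have h' : (b p : ℂ) * (ev p * cauchyTransform ev b q p) = 0 := by exact_mod_cast h p
    rw [h', zero_div]

/-- The test polynomial ∏ (X - λ_p) sees only the mass at the origin. -/
theorem eval_zero_of_orth {ev b : Fin N → ℝ} (hev : ∀ k, 0 < ev k) {M : ℝ} (hM : 0 < M)
    {q : ℝ[X]}
    (hq : ∀ f : ℝ[X], f.degree < (N + 1 : ℕ) → extendedForm ev b M f q = -f.eval 0) :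
    q.eval 0 = -(2 * M) := by
  have h := hq (Lagrange.nodal Finset.univ ev) (by
    rw [Lagrange.degree_nodal]; simpa using (by exact_mod_cast N.lt_succ_self))
  rw [extendedForm_apply, bimomentForm_eq_sum, Finset.sum_eq_zero fun p hp => by
    rw [Lagrange.eval_nodal_at_node hp, zero_mul], zero_add] at h
  have h0 : (Lagrange.nodal Finset.univ ev).eval 0 ≠ 0 :=
    Lagrange.eval_nodal_not_at_node fun i _ => (hev i).ne
  field_simp at h
  exact h

/-- The second derivative of the wave function to the right of all masses. -/
def targetA (ev : Fin N → ℝ) (M : ℝ) (z : ℂ) : ℂ :=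
  -(2 * M) * z * ∏ p, (1 - z / ev p)

theorem targetA_eq_zero_iff {ev : Fin N → ℝ} (hev : ∀ k, 0 < ev k) {M : ℝ} (hM : 0 < M) (z : ℂ) :
    targetA ev M z = 0 ↔ z = 0 ∨ ∃ k, z = (ev k : ℂ) := by
  have hM' : (M : ℂ) ≠ 0 := by exact_mod_cast hM.ne'
  have h : ∀ k, (1 - z / ev k = 0 ↔ z = ev k) := fun k => by
    have : (ev k : ℂ) ≠ 0 := by exact_mod_cast (hev k).ne'
    rw [sub_eq_zero, eq_comm, div_eq_one_iff_eq this]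
  simp [targetA, Finset.prod_eq_zero_iff, hM', h]

/-- With Ω = ∏ (X - λ_p), orthogonality is tested against the divided difference (Ω - Ω(z))/(X - z),
of degree below N. Its values Ω(z)/(z - λ_p) at the nodes reproduce the partial fractions of
`stateC`. -/
theorem targetA_mul_stateC {ev b : Fin N → ℝ} (hev : ∀ k, 0 < ev k) {M : ℝ} (hM : 0 < M)
    {R : ℝ[X]} (hR0 : R.eval 0 = 1)
    (hR : ∀ f : ℝ[X], f.degree < (N : ℕ) → extendedForm ev b M f R = 0) {z : ℂ} (hz : z ≠ 0)
    (hz' : ∀ k, z ≠ ev k) : targetA ev M z * stateC ev b M z R = 1 := by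
  set Ω : ℂ[X] := Lagrange.nodal Finset.univ fun p => (ev p : ℂ) with hΩ
  set c : Fin N → ℂ := fun p => (b p : ℂ) * cauchyTransform ev b R p with hc
  -- z is complex, so the real orthogonality relations are first extended by linearity from
  -- monomials to complex test polynomials.
  have horth : ∀ F : ℂ[X], F.degree < (N : ℕ) → ∑ p, F.eval (ev p : ℂ) * c p +
      F.eval 0 / (2 * M) = 0 := by
    intro F hF
    have hpow : ∀ i : Fin N, ∑ p, (ev p : ℂ) ^ (i : ℕ) * c p + (0 : ℂ) ^ (i : ℕ) / (2 * M) = 0 := by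
      intro i
      have := hR (X ^ (i : ℕ)) (by rw [degree_X_pow]; exact_mod_cast i.2)
      rw [extendedForm_apply, bimomentForm_eq_sum, hR0] at this
      simp only [eval_pow, eval_X, mul_one] at this
      have := congrArg (fun x : ℝ => (x : ℂ)) this
      push_cast at this
      simpa [hc] using this
    have hev' : ∀ x : ℂ, F.eval x = ∑ i : Fin N, F.coeff i * x ^ (i : ℕ) := by
      intro x
      rcases eq_or_ne F 0 with h | h
      · simp [h]
      · rw [eval_eq_sum_range' ((natDegree_lt_iff_degree_lt h).2 hF), Finset.sum_range]
    simp only [hev', Finset.sum_mul, Finset.sum_div]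
    rw [Finset.sum_comm, ← Finset.sum_add_distrib]
    refine Finset.sum_eq_zero fun i _ => ?_
    refine Eq.trans ?_ ((congrArg (F.coeff i * ·) (hpow i)).trans (mul_zero _))
    simp only [mul_add, Finset.mul_sum, mul_assoc, mul_div_assoc]
  set P : ℂ[X] := Ω - C (Ω.eval z) with hP
  have hroot : (X - C z) * (P /ₘ (X - C z)) = P := mul_divByMonic_eq_iff_isRoot.2 (by simp [hP])
  have hPdeg : P.degree ≤ (N : ℕ) := by
    refine (degree_sub_le _ _).trans (max_le ?_ (degree_C_le.trans ?_))
    · rw [hΩ, Lagrange.degree_nodal]; simp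
    · exact_mod_cast N.zero_le
  have hFdeg : (P /ₘ (X - C z)).degree < (N : ℕ) := by
    rcases eq_or_ne P 0 with h | h
    · simp [h]
    · exact (degree_divByMonic_lt P _ h (by simp [degree_X_sub_C])).trans_le hPdeg
  have hFe : ∀ x : ℂ, (x - z) * (P /ₘ (X - C z)).eval x = Ω.eval x - Ω.eval z := by
    intro x
    have := congrArg (fun f : ℂ[X] => f.eval x) hroot
    simpa [hP] using this
  have hFp : ∀ p, (P /ₘ (X - C z)).eval (ev p : ℂ) = Ω.eval z / (z - ev p) := by
    intro p
    have h1 := hFe (ev p)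
    have h2 : Ω.eval (ev p : ℂ) = 0 :=
      Lagrange.eval_nodal_at_node (v := fun p => (ev p : ℂ)) (Finset.mem_univ p)
    rw [h2] at h1
    rw [eq_div_iff (sub_ne_zero.2 (hz' p))]
    linear_combination -h1
  have hF0 : (P /ₘ (X - C z)).eval 0 = (Ω.eval z - Ω.eval 0) / z := by
    rw [eq_div_iff hz]
    linear_combination -hFe 0
  have key := horth _ hFdeg
  simp only [hFp, hF0] at key
  have hM' : (M : ℂ) ≠ 0 := by exact_mod_cast hM.ne'
  have h1 : z * Ω.eval z * stateC ev b M z R = -Ω.eval 0 / (2 * M) := by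
    have e : ∑ p, Ω.eval z / (z - ev p) * c p = Ω.eval z * ∑ p, c p / (z - ev p) := by
      rw [Finset.mul_sum]
      exact Finset.sum_congr rfl fun p _ => by ring
    rw [e] at key
    rw [stateC]
    field_simp at key ⊢
    linear_combination -key
  have hΩ0 : Ω.eval 0 = ∏ p, (-(ev p : ℂ)) := by simp [hΩ, Lagrange.eval_nodal]
  have hΩz : Ω.eval z = Ω.eval 0 * ∏ p, (1 - z / ev p) := by
    rw [hΩ0, ← Finset.prod_mul_distrib, hΩ, Lagrange.eval_nodal]
    refine Finset.prod_congr rfl fun p _ => ?_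
    have : (ev p : ℂ) ≠ 0 := by exact_mod_cast (hev p).ne'
    field_simp
    ring
  have hne : Ω.eval 0 ≠ 0 := by
    rw [hΩ0]
    exact Finset.prod_ne_zero_iff.2 fun p _ => neg_ne_zero.2 (by exact_mod_cast (hev p).ne')
  rw [hΩz] at h1
  refine mul_left_cancel₀ hne ?_
  rw [targetA]
  field_simp at h1 ⊢
  linear_combination -h1

end CubicStringInverse

/-! ### Quadratic splines and their derivatives -/

theorem ContDiffAt.differentiableAt_iteratedDeriv {f : ℝ → ℂ} {n : WithTop ℕ∞} {m : ℕ} {y : ℝ}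
    (h : ContDiffAt ℝ n f y) (hmn : m < n) : DifferentiableAt ℝ (iteratedDeriv m f) y := by
  rw [← differentiableWithinAt_univ, ← iteratedDerivWithin_univ]
  exact (contDiffWithinAt_univ.2 h).differentiableWithinAt_iteratedDerivWithin hmn
    (by simp [uniqueDiffOn_univ])

/-- The antiderivative with knots `x j` of a piecewise constant second derivative. -/
def quadraticSpline {n : ℕ} (x : Fin n → ℝ) (c : ℂ) (a : Fin n → ℂ) (y : ℝ) : ℂ :=
  c - ∑ j, a j * (((max (y - x j) 0) ^ 2 : ℝ) : ℂ)

theorem hasDerivAt_max_sub_of_ne (x : ℝ) {t : ℝ} (h : t ≠ x) :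
    HasDerivAt (fun t => max (t - x) 0) (if x < t then 1 else 0) t := by
  rcases lt_or_gt_of_ne h with h | h
  · rw [if_neg h.le.not_gt]
    refine (hasDerivAt_const t (0 : ℝ)).congr_of_eventuallyEq ?_
    filter_upwards [Iio_mem_nhds h] with s hs
    exact max_eq_right (sub_nonpos.2 (le_of_lt hs))
  · rw [if_pos h]
    refine ((hasDerivAt_id t).sub_const x).congr_of_eventuallyEq ?_
    filter_upwards [Ioi_mem_nhds h] with s hs
    exact max_eq_left (sub_nonneg.2 (le_of_lt hs))

theorem hasDerivAt_max_sub_sq (x t : ℝ) :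
    HasDerivAt (fun t => (max (t - x) 0) ^ 2) (2 * max (t - x) 0) t := by
  refine hasDerivAt_of_hasDerivAt_of_ne' (g := fun t => 2 * max (t - x) 0) (x := x)
    (fun y hy => ?_) (by fun_prop) (by fun_prop) t
  refine ((hasDerivAt_max_sub_of_ne x hy).pow 2).congr_deriv ?_
  split_ifs with h
  · simp
  · rw [max_eq_right (by linarith [not_lt.1 h])]; simp

section
variable {n : ℕ} (x : Fin n → ℝ) (c : ℂ) (a : Fin n → ℂ)

theorem hasDerivAt_quadraticSpline (y : ℝ) : HasDerivAt (quadraticSpline x c a)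
    (-∑ j, 2 * a j * ((max (y - x j) 0 : ℝ) : ℂ)) y := by
  have h : HasDerivAt (fun y => ∑ j, a j * (((max (y - x j) 0) ^ 2 : ℝ) : ℂ))
      (∑ j, a j * ((2 * max (y - x j) 0 : ℝ) : ℂ)) y :=
    HasDerivAt.fun_sum fun j _ => (hasDerivAt_max_sub_sq (x j) y).ofReal_comp.const_mul (a j)
  refine (h.const_sub c).congr_deriv ?_
  congr 1
  refine Finset.sum_congr rfl fun j _ => ?_
  push_cast
  ring

theorem deriv_quadraticSpline : deriv (quadraticSpline x c a) =
    fun y => -∑ j, 2 * a j * ((max (y - x j) 0 : ℝ) : ℂ) :=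
  funext fun y => (hasDerivAt_quadraticSpline x c a y).deriv

theorem continuous_linearSpline :
    Continuous fun y : ℝ => ∑ j, 2 * a j * ((max (y - x j) 0 : ℝ) : ℂ) := by
  fun_prop

theorem contDiff_quadraticSpline : ContDiff ℝ 1 (quadraticSpline x c a) := by
  rw [contDiff_one_iff_deriv, deriv_quadraticSpline]
  exact ⟨fun y => (hasDerivAt_quadraticSpline x c a y).differentiableAt,
    (continuous_linearSpline x a).neg⟩

theorem hasDerivAt_linearSpline {y : ℝ} (hy : y ∉ Set.range x) :
    HasDerivAt (fun y : ℝ => ∑ j, 2 * a j * ((max (y - x j) 0 : ℝ) : ℂ))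
      (∑ j, 2 * a j * (if x j < y then 1 else 0)) y := by
  refine HasDerivAt.fun_sum fun j _ => ?_
  have h := (hasDerivAt_max_sub_of_ne (x j) (t := y) fun h => hy ⟨j, h.symm⟩).ofReal_comp.const_mul
    (2 * a j)
  refine h.congr_deriv ?_
  split_ifs <;> simp

theorem eventually_notMem_range (y : ℝ) : ∀ᶠ t in 𝓝[≠] y, t ∉ Set.range x := by
  have h : IsClosed (Set.range x \ {y}) := ((Set.finite_range x).subset Set.sdiff_subset).isClosed
  have h1 : ∀ᶠ t in 𝓝 y, t ∉ Set.range x \ {y} := h.isOpen_compl.mem_nhds (by simp)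
  filter_upwards [h1.filter_mono nhdsWithin_le_nhds, self_mem_nhdsWithin] with t ht hty hr
  exact ht ⟨hr, hty⟩

theorem eventually_notMem_range_of_notMem {y : ℝ} (hy : y ∉ Set.range x) :
    ∀ᶠ t in 𝓝 y, t ∉ Set.range x :=
  (Set.finite_range x).isClosed.isOpen_compl.mem_nhds hy

theorem iteratedDeriv_two_quadraticSpline {y : ℝ} (hy : y ∉ Set.range x) :
    iteratedDeriv 2 (quadraticSpline x c a) y = -∑ j, 2 * a j * (if x j < y then 1 else 0) := by
  rw [iteratedDeriv_succ, iteratedDeriv_one, deriv_quadraticSpline]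
  exact (hasDerivAt_linearSpline x a hy).neg.deriv

theorem eventually_step_eq_right (y : ℝ) : ∀ᶠ t in 𝓝[>] y,
    (∑ j, 2 * a j * (if x j < t then 1 else 0)) = ∑ j, 2 * a j * (if x j ≤ y then 1 else 0) := by
  have h : ∀ j, ∀ᶠ t in 𝓝[>] y, (x j < t ↔ x j ≤ y) := fun j => by
    rcases le_or_gt (x j) y with h | h
    · filter_upwards [self_mem_nhdsWithin] with t ht
      exact iff_of_true (h.trans_lt ht) h
    · filter_upwards [nhdsWithin_le_nhds (Iio_mem_nhds h)] with t ht
      exact iff_of_false (not_lt.2 (le_of_lt ht)) (not_le.2 h)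
  filter_upwards [eventually_all.2 h] with t ht
  simp only [ht]

theorem eventually_step_eq_left (y : ℝ) : ∀ᶠ t in 𝓝[≤] y,
    (∑ j, 2 * a j * (if x j < t then 1 else 0)) = ∑ j, 2 * a j * (if x j < y then 1 else 0) := by
  have h : ∀ j, ∀ᶠ t in 𝓝[≤] y, (x j < t ↔ x j < y) := fun j => by
    rcases le_or_gt y (x j) with h | h
    · filter_upwards [self_mem_nhdsWithin] with t ht
      exact iff_of_false (not_lt.2 (le_trans ht h)) (not_lt.2 h)
    · filter_upwards [nhdsWithin_le_nhds (Ioi_mem_nhds h)] with t ht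
      exact iff_of_true ht h
  filter_upwards [eventually_all.2 h] with t ht
  simp only [ht]

theorem eventually_step_eq {y : ℝ} (hy : y ∉ Set.range x) : ∀ᶠ t in 𝓝 y,
    (∑ j, 2 * a j * (if x j < t then 1 else 0)) = ∑ j, 2 * a j * (if x j < y then 1 else 0) := by
  have h : ∀ᶠ t in 𝓝[>] y, (∑ j, 2 * a j * (if x j < t then 1 else 0)) =
      ∑ j, 2 * a j * (if x j < y then 1 else 0) := by
    filter_upwards [eventually_step_eq_right x a y] with t ht
    rw [ht]
    refine Finset.sum_congr rfl fun j _ => ?_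
    have : x j ≤ y ↔ x j < y := ⟨fun h => h.lt_of_ne fun h => hy ⟨j, h⟩, le_of_lt⟩
    simp only [this]
  rw [← nhdsLE_sup_nhdsGT]
  exact eventually_sup.2 ⟨eventually_step_eq_left x a y, h⟩

theorem tendsto_iteratedDeriv_two_right (y : ℝ) :
    Tendsto (iteratedDeriv 2 (quadraticSpline x c a)) (𝓝[>] y)
      (𝓝 (-∑ j, 2 * a j * (if x j ≤ y then 1 else 0))) := by
  refine tendsto_const_nhds.congr' ?_
  filter_upwards [eventually_step_eq_right x a y,
    (eventually_notMem_range x y).filter_mono (nhdsWithin_mono _ fun t ht => (ne_of_gt ht : t ≠ y))]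
    with t h1 h2
  rw [iteratedDeriv_two_quadraticSpline x c a h2, h1]

theorem tendsto_iteratedDeriv_two_left (y : ℝ) :
    Tendsto (iteratedDeriv 2 (quadraticSpline x c a)) (𝓝[<] y)
      (𝓝 (-∑ j, 2 * a j * (if x j < y then 1 else 0))) := by
  refine tendsto_const_nhds.congr' ?_
  filter_upwards [(eventually_step_eq_left x a y).filter_mono
      (nhdsWithin_mono _ Set.Iio_subset_Iic_self),
    (eventually_notMem_range x y).filter_mono (nhdsWithin_mono _ fun t ht => (ne_of_lt ht : t ≠ y))]
    with t h1 h2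
  rw [iteratedDeriv_two_quadraticSpline x c a h2, h1]

theorem tendsto_iteratedDeriv_two_atTop :
    Tendsto (iteratedDeriv 2 (quadraticSpline x c a)) atTop (𝓝 (-∑ j, 2 * a j)) := by
  refine tendsto_const_nhds.congr' ?_
  filter_upwards [eventually_all.2 fun j => eventually_gt_atTop (x j)] with t ht
  rw [iteratedDeriv_two_quadraticSpline x c a fun ⟨j, hj⟩ => (ht j).ne hj]
  simp [ht]

theorem eventually_atBot_quadraticSpline : ∀ᶠ t in atBot,
    deriv (quadraticSpline x c a) t = 0 ∧ iteratedDeriv 2 (quadraticSpline x c a) t = 0 := by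
  filter_upwards [eventually_all.2 fun j => eventually_lt_atBot (x j)] with t ht
  rw [iteratedDeriv_two_quadraticSpline x c a fun ⟨j, hj⟩ => (ht j).ne' hj, deriv_quadraticSpline]
  have h1 : ∀ j, max (t - x j) 0 = 0 := fun j => max_eq_right (by linarith [ht j])
  have h2 : ∀ j, ¬ x j < t := fun j => (ht j).le.not_gt
  simp [h1, h2]

theorem contDiffAt_quadraticSpline {y : ℝ} (hy : y ∉ Set.range x) :
    ContDiffAt ℝ 3 (quadraticSpline x c a) y ∧ iteratedDeriv 3 (quadraticSpline x c a) y = 0 := by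
  constructor
  · have h : ∀ j, ContDiffAt ℝ 3 (fun t => max (t - x j) 0) y := fun j => by
      rcases lt_or_gt_of_ne (fun h => hy ⟨j, h.symm⟩ : y ≠ x j) with h | h
      · refine (contDiffAt_const (c := (0 : ℝ))).congr_of_eventuallyEq ?_
        filter_upwards [Iio_mem_nhds h] with s hs
        exact max_eq_right (sub_nonpos.2 (le_of_lt hs))
      · refine (contDiffAt_id.sub (contDiffAt_const (c := x j))).congr_of_eventuallyEq ?_
        filter_upwards [Ioi_mem_nhds h] with s hs
        exact max_eq_left (sub_nonneg.2 (le_of_lt hs))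
    refine contDiffAt_const.sub (ContDiffAt.sum fun j _ => contDiffAt_const.mul ?_)
    exact Complex.ofRealCLM.contDiff.contDiffAt.comp y ((h j).pow 2)
  · rw [iteratedDeriv_succ]
    have h : iteratedDeriv 2 (quadraticSpline x c a) =ᶠ[𝓝 y]
        fun _ => -∑ j, 2 * a j * (if x j < y then 1 else 0) := by
      filter_upwards [eventually_step_eq x a hy, eventually_notMem_range_of_notMem x hy]
        with t h1 h2
      rw [iteratedDeriv_two_quadraticSpline x c a h2, h1]
    rw [h.deriv_eq, deriv_const]

end

/-! ### Solutions of the string equation as quadratic splines; the wave function -/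

namespace DiscreteCubicString

variable {n : ℕ} (S : DiscreteCubicString n)

theorem isSolution_quadraticSpline {z c : ℂ} {a : Fin n → ℂ}
    (ha : ∀ j, a j = z * S.mass j * quadraticSpline S.pos c a (S.pos j)) :
    S.IsSolution z (quadraticSpline S.pos c a) where
  contDiff_one := contDiff_quadraticSpline _ _ _
  off_support y hy := contDiffAt_quadraticSpline _ _ _ hy
  jump k := by
    refine ⟨_, _, tendsto_iteratedDeriv_two_left _ _ _ _, tendsto_iteratedDeriv_two_right _ _ _ _,
      ?_⟩
    have h : ∀ j, 2 * a j * (if S.pos j ≤ S.pos k then 1 else 0) =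
        2 * a j * (if S.pos j < S.pos k then 1 else 0) + (if j = k then 2 * a j else 0) := by
      intro j
      simp only [S.pos_strictMono.lt_iff_lt, S.pos_strictMono.le_iff_le]
      rcases lt_trichotomy j k with h | h | h
      · simp [h, h.le, h.ne]
      · simp [h]
      · simp [h.le.not_gt, h.not_ge, h.ne']
    simp only [h, Finset.sum_add_distrib, Finset.sum_ite_eq', Finset.mem_univ, if_true]
    rw [ha k]
    ring

/-- Adding the step function with the opposite jumps to φ'' removes its discontinuities; the result
is constant, hence 0 by its limit at -∞. The same argument one order lower determines φ', so φ is
fixed up to a constant. -/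
theorem IsSolution.eq_quadraticSpline {z : ℂ} {φ : ℝ → ℂ} (h : S.IsSolution z φ)
    (h1 : Tendsto (deriv φ) atBot (𝓝 0)) (h2 : Tendsto (iteratedDeriv 2 φ) atBot (𝓝 0)) :
    ∃ c, φ = quadraticSpline S.pos c fun j => z * S.mass j * φ (S.pos j) := by
  classical
  set a : Fin n → ℂ := fun j => z * S.mass j * φ (S.pos j) with ha
  set x := S.pos with hx
  obtain ⟨hdiff, hcont⟩ := contDiff_one_iff_deriv.1 h.contDiff_one
  set u : ℝ → ℂ := fun y => deriv φ y + ∑ j, 2 * a j * ((max (y - x j) 0 : ℝ) : ℂ) with hu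
  set g : ℝ → ℂ := fun y => iteratedDeriv 2 φ y + ∑ j, 2 * a j * (if x j < y then 1 else 0) with hg
  have hucont : Continuous u := hcont.add (continuous_linearSpline x a)
  have hφ2 : ∀ y ∉ Set.range x, HasDerivAt (iteratedDeriv 2 φ) 0 y := fun y hy => by
    obtain ⟨hc, h0⟩ := h.off_support y hy
    have hd : DifferentiableAt ℝ (iteratedDeriv 2 φ) y :=
      hc.differentiableAt_iteratedDeriv (by norm_num)
    rw [iteratedDeriv_succ] at h0
    exact h0 ▸ hd.hasDerivAt
  have hug : ∀ y ∉ Set.range x, HasDerivAt u (g y) y := fun y hy => by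
    refine HasDerivAt.add ?_ (hasDerivAt_linearSpline x a hy)
    obtain ⟨hc, -⟩ := h.off_support y hy
    have hd : DifferentiableAt ℝ (iteratedDeriv 1 φ) y :=
      hc.differentiableAt_iteratedDeriv (by norm_num)
    rw [iteratedDeriv_succ, iteratedDeriv_one]
    rw [iteratedDeriv_one] at hd
    exact hd.hasDerivAt
  have hg0 : ∀ y ∉ Set.range x, HasDerivAt g 0 y := fun y hy => by
    exact ((hφ2 y hy).add (((hasDerivAt_const y _).congr_of_eventuallyEq
      (eventually_step_eq x a hy)))).congr_deriv (add_zero 0)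
  have hlim : ∀ k, ∃ L, Tendsto g (𝓝[≠] (x k)) (𝓝 L) := fun k => by
    obtain ⟨l, r, hl, hr, hlr⟩ := h.jump k
    refine ⟨l + ∑ j, 2 * a j * (if x j < x k then 1 else 0), ?_⟩
    rw [← nhdsLT_sup_nhdsGT]
    refine Tendsto.sup ?_ ?_
    · refine hl.add (tendsto_const_nhds.congr' ?_)
      filter_upwards [(eventually_step_eq_left x a (x k)).filter_mono
        (nhdsWithin_mono _ Set.Iio_subset_Iic_self)] with t ht using ht.symm
    · have e : l + ∑ j, 2 * a j * (if x j < x k then 1 else 0) =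
          r + ∑ j, 2 * a j * (if x j ≤ x k then 1 else 0) := by
        have h' : ∀ j, 2 * a j * (if x j ≤ x k then 1 else 0) =
            2 * a j * (if x j < x k then 1 else 0) + (if j = k then 2 * a j else 0) := by
          intro j
          simp only [hx, S.pos_strictMono.lt_iff_lt, S.pos_strictMono.le_iff_le]
          rcases lt_trichotomy j k with h | h | h
          · simp [h, h.le, h.ne]
          · simp [h]
          · simp [h.le.not_gt, h.not_ge, h.ne']
        simp only [h', Finset.sum_add_distrib, Finset.sum_ite_eq', Finset.mem_univ, if_true]
        simp only [ha]
        linear_combination -hlr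
      rw [e]
      refine hr.add (tendsto_const_nhds.congr' ?_)
      filter_upwards [eventually_step_eq_right x a (x k)] with t ht using ht.symm
  choose L hL using hlim
  -- The value of `iteratedDeriv 2 φ` at a mass is arbitrary, so g is redefined there by its limits
  -- to become continuous.
  set G : ℝ → ℂ := fun y => if hy : y ∈ Set.range x then L hy.choose else g y with hG
  have hGg : ∀ y ∉ Set.range x, G y = g y := fun y hy => by simp only [hG, dif_neg hy]
  have hGev : ∀ y ∉ Set.range x, G =ᶠ[𝓝 y] g := fun y hy => by
    filter_upwards [eventually_notMem_range_of_notMem x hy] with t ht using hGg t ht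
  have hG0 : ∀ y ∉ Set.range x, HasDerivAt G 0 y := fun y hy =>
    (hg0 y hy).congr_of_eventuallyEq (hGev y hy)
  have hGcont : Continuous G := by
    rw [continuous_iff_continuousAt]
    intro y
    by_cases hy : y ∈ Set.range x
    · have e : G y = L hy.choose := by simp only [hG, dif_pos hy]
      rw [continuousAt_iff_punctured_nhds, e]
      have := hL hy.choose
      rw [hy.choose_spec] at this
      refine this.congr' ?_
      filter_upwards [eventually_notMem_range x y] with t ht using (hGg t ht).symm
    · exact (hG0 y hy).continuousAt
  have hGconst : ∀ y, G y = G 0 := fun y => by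
    have := MeasureTheory.integral_eq_of_hasDerivAt_off_countable (a := 0) (b := y) G
      (fun _ => 0) (Set.finite_range x).countable hGcont.continuousOn
      (fun t ht => hG0 t ht.2) (by simp)
    rw [intervalIntegral.integral_zero] at this
    exact (sub_eq_zero.1 this.symm)
  have hbot : ∀ᶠ t in atBot, (∀ j, t < x j) := eventually_all.2 fun j => eventually_lt_atBot (x j)
  have hG00 : G 0 = 0 := by
    refine tendsto_nhds_unique (tendsto_const_nhds.congr' ?_) h2
    filter_upwards [hbot] with t ht
    have hn : t ∉ Set.range x := fun ⟨j, hj⟩ => (ht j).ne' hj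
    have h3 : ∀ j, ¬ x j < t := fun j => (ht j).le.not_gt
    rw [← hGconst t, hGg t hn, hg]
    simp [h3]
  have huconst : ∀ y, u y = u 0 := fun y => by
    have := MeasureTheory.integral_eq_of_hasDerivAt_off_countable (a := 0) (b := y) u
      G (Set.finite_range x).countable hucont.continuousOn
      (fun t ht => by rw [hGg t ht.2]; exact hug t ht.2) (hGcont.intervalIntegrable _ _)
    simp only [hGconst, hG00, intervalIntegral.integral_zero] at this
    exact (sub_eq_zero.1 this.symm)
  have hu0 : u 0 = 0 := by
    refine tendsto_nhds_unique (tendsto_const_nhds.congr' ?_) h1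
    filter_upwards [hbot] with t ht
    have h3 : ∀ j, max (t - x j) 0 = 0 := fun j => max_eq_right (by linarith [ht j])
    rw [← huconst t, hu]
    simp [h3]
  have hconst : ∀ y, φ y - quadraticSpline x 0 a y = φ 0 - quadraticSpline x 0 a 0 := fun y => by
    refine is_const_of_deriv_eq_zero (f := fun y => φ y - quadraticSpline x 0 a y)
      (fun y => (hdiff y).sub (hasDerivAt_quadraticSpline x 0 a y).differentiableAt) (fun y => ?_) y 0
    refine ((hdiff y).hasDerivAt.sub (hasDerivAt_quadraticSpline x 0 a y)).deriv.trans ?_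
    rw [sub_neg_eq_add]
    exact (huconst y).trans hu0
  refine ⟨φ 0 - quadraticSpline x 0 a 0, funext fun y => ?_⟩
  have h3 := hconst y
  simp only [quadraticSpline, zero_sub] at h3 ⊢
  linear_combination h3

end DiscreteCubicString

namespace DiscreteCubicString

section
variable {n : ℕ} (S : DiscreteCubicString n)

/-- The value at the `j`-th mass of the wave function, the solution equal to `1` on the left. -/
def waveValue (z : ℂ) (j : Fin n) : ℂ :=
  1 - z * ∑ i : {i : Fin n // i < j}, S.mass i * waveValue z i * (S.pos j - S.pos i) ^ 2
termination_by j.val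
decreasing_by exact i.2

theorem waveValue_eq (z : ℂ) (j : Fin n) : S.waveValue z j =
    1 - z * ∑ i ∈ Finset.Iio j, S.mass i * S.waveValue z i * (S.pos j - S.pos i) ^ 2 := by
  rw [waveValue]
  congr 2
  exact (Finset.sum_subtype (Finset.Iio j) (fun i => Finset.mem_Iio)
    fun i => (S.mass i : ℂ) * S.waveValue z i * (S.pos j - S.pos i) ^ 2).symm

theorem continuous_waveValue (j : Fin n) : Continuous fun z => S.waveValue z j := by
  induction j using WellFoundedLT.induction with
  | ind j ih =>
    simp only [S.waveValue_eq _ j]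
    refine continuous_const.sub (continuous_id.mul (continuous_finsetSum _ fun i hi => ?_))
    have := ih i (Finset.mem_Iio.1 hi)
    fun_prop

/-- Minus half of the second derivative of the wave function to the right of all masses. -/
def waveEnd (z : ℂ) : ℂ := z * ∑ j, S.mass j * S.waveValue z j

theorem continuous_waveEnd : Continuous S.waveEnd := by
  have := S.continuous_waveValue
  unfold waveEnd
  fun_prop

theorem quadraticSpline_pos (c : ℂ) (a : Fin n → ℂ) (j : Fin n) :
    quadraticSpline S.pos c a (S.pos j) =
      c - ∑ i ∈ Finset.Iio j, a i * (S.pos j - S.pos i) ^ 2 := by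
  rw [quadraticSpline]
  congr 1
  symm
  refine Finset.sum_subset_zero_on_sdiff (Finset.subset_univ _) (fun i hi => ?_) fun i hi => ?_
  · have : j ≤ i := by simpa using hi
    rw [max_eq_right (sub_nonpos.2 (S.pos_strictMono.monotone this))]
    simp
  · have : i ≤ j := (Finset.mem_Iio.1 hi).le
    rw [max_eq_left (sub_nonneg.2 (S.pos_strictMono.monotone this))]
    push_cast
    rfl

theorem quadraticSpline_wave (z c : ℂ) (j : Fin n) :
    quadraticSpline S.pos c (fun i => z * S.mass i * (c * S.waveValue z i)) (S.pos j) =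
      c * S.waveValue z j := by
  rw [quadraticSpline_pos, waveValue_eq, mul_sub, mul_one, Finset.mul_sum, Finset.mul_sum]
  congr 1
  exact Finset.sum_congr rfl fun i _ => by ring

/-- The spline at x_j involves only the masses strictly to its left, so the values are determined
recursively by c. -/
theorem eq_mul_waveValue {z c : ℂ} {v : Fin n → ℂ}
    (h : ∀ j, v j = quadraticSpline S.pos c (fun i => z * S.mass i * v i) (S.pos j)) (j : Fin n) :
    v j = c * S.waveValue z j := by
  induction j using WellFoundedLT.induction with
  | ind j ih =>
    rw [h j, ← quadraticSpline_wave, quadraticSpline_pos, quadraticSpline_pos]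
    congr 1
    exact Finset.sum_congr rfl fun i hi => by rw [ih i (Finset.mem_Iio.1 hi)]

/-- The wave function. -/
def wave (z : ℂ) : ℝ → ℂ :=
  quadraticSpline S.pos 1 fun i => z * S.mass i * (1 * S.waveValue z i)

theorem isSolution_wave (z : ℂ) : S.IsSolution z (S.wave z) :=
  S.isSolution_quadraticSpline fun j => by rw [quadraticSpline_wave]

theorem wave_eq_one {z : ℂ} {y : ℝ} (hy : ∀ j, y < S.pos j) : S.wave z y = 1 := by
  have h1 : ∀ j, max (y - S.pos j) 0 = 0 := fun j => max_eq_right (by linarith [hy j])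
  simp [wave, quadraticSpline, h1]

/-- The conditions at -∞ leave only the multiples cφ of the wave function, and c = 0 would make the
solution vanish. -/
theorem isEigenvalue_iff (z : ℂ) : S.IsEigenvalue z ↔ S.waveEnd z = 0 := by
  constructor
  · rintro ⟨φ, hφ, hsol, h1, h2, h3⟩
    obtain ⟨c, hc⟩ := hsol.eq_quadraticSpline S h1 h2
    have hv := S.eq_mul_waveValue (z := z) (c := c) (v := fun j => φ (S.pos j))
      fun j => congrFun hc (S.pos j)
    simp only [hv] at hc
    have h4 := tendsto_iteratedDeriv_two_atTop S.pos c
      fun i => z * S.mass i * (c * S.waveValue z i)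
    rw [← hc] at h4
    have h5 := tendsto_nhds_unique h3 h4
    have h6 : c * S.waveEnd z = 0 := by
      have e : ∑ j, 2 * (z * S.mass j * (c * S.waveValue z j)) = 2 * (c * S.waveEnd z) := by
        rw [waveEnd, Finset.mul_sum, Finset.mul_sum, Finset.mul_sum]
        exact Finset.sum_congr rfl fun j _ => by ring
      rw [e] at h5
      linear_combination (-1 / 2 : ℂ) * h5.symm
    refine (mul_eq_zero.1 h6).resolve_left fun h0 => hφ ?_
    rw [hc, h0]
    ext y
    simp [quadraticSpline]
  · intro h
    have hbot := eventually_atBot_quadraticSpline S.pos 1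
      fun i => z * S.mass i * (1 * S.waveValue z i)
    refine ⟨S.wave z, fun h0 => ?_, S.isSolution_wave z, ?_, ?_, ?_⟩
    · obtain ⟨y, hy⟩ := (eventually_all.2 fun j => eventually_lt_atBot (S.pos j)).exists
      have := S.wave_eq_one (z := z) hy
      rw [h0] at this
      exact zero_ne_one this
    · exact tendsto_const_nhds.congr' (hbot.mono fun t ht => ht.1.symm)
    · exact tendsto_const_nhds.congr' (hbot.mono fun t ht => ht.2.symm)
    · have h4 := tendsto_iteratedDeriv_two_atTop S.pos 1
        fun i => z * S.mass i * (1 * S.waveValue z i)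
      have e : -∑ j, 2 * (z * S.mass j * (1 * S.waveValue z j)) = 0 := by
        rw [← mul_zero (-2 : ℂ), ← h, waveEnd, Finset.mul_sum, Finset.mul_sum,
          ← Finset.sum_neg_distrib]
        exact Finset.sum_congr rfl fun j _ => by ring
      rwa [e] at h4

end

theorem hasWeylValue {N : ℕ} (S : DiscreteCubicString (N + 1)) {z : ℂ} (h : S.waveEnd z ≠ 0) :
    S.HasWeylValue z ((-(2 * z) * ∑ i, S.mass i * S.waveValue z i *
      (S.pos (Fin.last N) - S.pos i)) / (-2 * S.waveEnd z)) := by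
  have hle : ∀ i, S.pos i ≤ S.pos (Fin.last N) := fun i => S.pos_strictMono.monotone (Fin.le_last i)
  refine ⟨S.wave z, _, _, S.isSolution_wave z, fun y hy => S.wave_eq_one fun j =>
    hy.trans_le (S.pos_strictMono.monotone (Fin.zero_le j)), ?_, ?_,
    mul_ne_zero (by norm_num) h, rfl⟩
  · have hc : Continuous (deriv (S.wave z)) :=
      (contDiff_one_iff_deriv.1 (S.isSolution_wave z).contDiff_one).2
    have := (hc.tendsto (S.pos (Fin.last N))).mono_left
      (nhdsWithin_le_nhds (s := Set.Ioi (S.pos (Fin.last N))))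
    have e : deriv (S.wave z) (S.pos (Fin.last N)) = -(2 * z) * ∑ i, S.mass i * S.waveValue z i *
        (S.pos (Fin.last N) - S.pos i) := by
      rw [wave, deriv_quadraticSpline, Finset.mul_sum]
      simp only [← Finset.sum_neg_distrib]
      refine Finset.sum_congr rfl fun i _ => ?_
      rw [max_eq_left (sub_nonneg.2 (hle i))]
      push_cast
      ring
    rwa [e] at this
  · have := tendsto_iteratedDeriv_two_right S.pos 1
      (fun i => z * S.mass i * (1 * S.waveValue z i)) (S.pos (Fin.last N))
    have e : -∑ i, 2 * (z * S.mass i * (1 * S.waveValue z i)) *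
        (if S.pos i ≤ S.pos (Fin.last N) then 1 else 0) = -2 * S.waveEnd z := by
      rw [waveEnd, Finset.mul_sum, Finset.mul_sum, ← Finset.sum_neg_distrib]
      refine Finset.sum_congr rfl fun i _ => ?_
      rw [if_pos (hle i)]
      ring
    rwa [e] at this

end DiscreteCubicString

/-! ### Identification of the wave function and the spectral data -/

namespace CubicStringInverse
open Polynomial

variable {N : ℕ} {ev b : Fin N → ℝ} {M : ℝ} (hev : ∀ k, 0 < ev k) (hinj : Function.Injective ev)
  (hb : ∀ k, b k < 0) (hM : 0 < M)
include hev hinj hb hM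

theorem q_succ_peelFormula {k : ℕ} (hk : k ≤ N) (f : ℝ[X]) (hf : f.degree < (k + 1 : ℕ)) :
    extendedForm ev b M f (peelFormula ev b M (k + 1)).1 = -f.eval 0 :=
  ((peelInvariant_peelFormula hev hinj hb hM hk).q_succ hev hinj hb hM hk).2.2 f hf

theorem extendedForm_one_peelFormula {k : ℕ} (hk : k ≤ N) :
    extendedForm ev b M 1 (peelFormula ev b M (k + 1)).1 = -1 := by
  have := q_succ_peelFormula hev hinj hb hM hk 1
    (by rw [degree_one]; exact_mod_cast k.succ_pos)
  simpa using this

theorem stateA_peelFormula_succ {k : ℕ} (hk : k ≤ N) {z : ℂ} (hz : z ≠ 0)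
    (hz' : ∀ k, z ≠ ev k) : stateA ev b M z (peelFormula ev b M (k + 1)).1 =
      stateA ev b M z (peelFormula ev b M k).1 +
        2 * z * massFormula ev b M k * stateC ev b M z (peelFormula ev b M k).2.2 :=
  stateA_sub_smul hz hz' _ (peelInvariant_peelFormula hev hinj hb hM hk).R_zero _

theorem stateB_peelFormula_succ {k : ℕ} (hk : k + 1 ≤ N) (z : ℂ) :
    stateB ev b z (peelFormula ev b M (k + 1)).2.1 = stateB ev b z (peelFormula ev b M k).2.1 -
      lengthFormula ev b M (k + 1) * stateA ev b M z (peelFormula ev b M (k + 1)).1 :=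
  stateB_add_smul ev b z _
    (extendedForm_one_peelFormula hev hinj hb hM (show k ≤ N by omega)) _

theorem stateC_peelFormula_succ {k : ℕ} (hk : k + 1 ≤ N) (z : ℂ) :
    stateC ev b M z (peelFormula ev b M (k + 1)).2.2 = stateC ev b M z (peelFormula ev b M k).2.2 -
      lengthFormula ev b M (k + 1) * stateB ev b z (peelFormula ev b M k).2.1 +
      (lengthFormula ev b M (k + 1) : ℂ) ^ 2 / 2 *
        stateA ev b M z (peelFormula ev b M (k + 1)).1 := by
  refine stateC_add_smul hev z _ _
    (extendedForm_one_peelFormula hev hinj hb hM (show k ≤ N by omega)) ?_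
  have hl := lengthFormula_mul_momentMap hev hinj hb hM hk
    ((peelInvariant_peelFormula hev hinj hb hM (show k ≤ N by omega)).q_succ hev hinj hb hM
      (show k ≤ N by omega)).1 (q_succ_peelFormula hev hinj hb hM (show k ≤ N by omega))
  have hs := (peelInvariant_peelFormula hev hinj hb hM (show k ≤ N by omega)).s_moment
  change lengthFormula ev b M (k + 1) * momentMap ev b (peelFormula ev b M k).2.1 +
    lengthFormula ev b M (k + 1) ^ 2 / 2 * momentMap ev b ((peelFormula ev b M k).1 +
      -(2 * massFormula ev b M k) • (peelFormula ev b M k).2.2) = lengthFormula ev b M (k + 1)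
  rw [hs]
  linear_combination lengthFormula ev b M (k + 1) / 2 * hl

/-- The three left-hand sides are φ(x_j), φ''(x_j+) and φ'(x_j). At the first mass they match by the
relations at k = N; moving right, the peeling recursions are read backwards. -/
theorem wave_state {S : DiscreteCubicString (N + 1)} (hS : IsGivenByFormulas S ev b M) {z : ℂ}
    (hz : z ≠ 0) (hz' : ∀ k, z ≠ ev k) (j : Fin (N + 1)) : ∀ k : ℕ, (j : ℕ) + k = N →
    S.waveValue z j = targetA ev M z * stateC ev b M z (peelFormula ev b M k).2.2 ∧
    -(2 * z) * ∑ i ∈ Finset.Iic j, S.mass i * S.waveValue z i =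
      targetA ev M z * stateA ev b M z (peelFormula ev b M k).1 ∧
    -(2 * z) * ∑ i ∈ Finset.Iic j, S.mass i * S.waveValue z i * (S.pos j - S.pos i) =
      targetA ev M z * stateB ev b z (peelFormula ev b M k).2.1 := by
  induction j using Fin.induction with
  | zero =>
    intro k hk
    obtain rfl : k = N := by simpa using hk
    have hI := peelInvariant_peelFormula hev hinj hb hM le_rfl
    have hC := targetA_mul_stateC hev hM hI.R_zero hI.R_orth hz hz'
    have hB := stateB_eq_zero hinj hI.s_orth z
    have hA := stateA_peelFormula_succ hev hinj hb hM le_rfl hz hz'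
    -- The polynomial q_{N+1} stands for φ'' left of the first mass, which must vanish.
    rw [stateA_eq_zero hinj (q_succ_peelFormula hev hinj hb hM le_rfl)] at hA
    have h0 : S.waveValue z 0 = 1 := by rw [S.waveValue_eq, show Finset.Iio (0 : Fin (k + 1)) = ∅ by ext; simp]; simp
    have hI0 : Finset.Iic (0 : Fin (k + 1)) = {0} := rfl
    have hm := hS.1 0
    simp only [Fin.val_zero, Nat.sub_zero] at hm
    rw [hC, hB, hI0, Finset.sum_singleton, Finset.sum_singleton, h0, hm]
    refine ⟨rfl, ?_, by simp⟩
    linear_combination targetA ev M z * hA + 2 * z * massFormula ev b M k * hC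
  | succ j ih =>
    intro k hk
    have hjk : (j : ℕ) + 1 + k = N := by simpa using hk
    obtain ⟨h1, h2, h3⟩ := ih (k + 1) (by simp; omega)
    have hA := stateA_peelFormula_succ hev hinj hb hM (show k ≤ N by omega) hz hz'
    have hB := stateB_peelFormula_succ hev hinj hb hM (show k + 1 ≤ N by omega) z
    have hC := stateC_peelFormula_succ hev hinj hb hM (show k + 1 ≤ N by omega) z
    have hm := hS.1 j.succ
    have hl := hS.2 j
    rw [show N - ((j.succ : Fin (N + 1)) : ℕ) = k by simp; omega] at hm
    rw [show N - (j : ℕ) = k + 1 by omega] at hl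
    have hpos : S.pos j.succ = S.pos j.castSucc + lengthFormula ev b M (k + 1) := by linarith
    set l := lengthFormula ev b M (k + 1)
    have hIio : Finset.Iio j.succ = Finset.Iic j.castSucc := by
      ext i; simp [Fin.lt_def, Fin.le_def]
    have hIic : Finset.Iic j.succ = insert j.succ (Finset.Iic j.castSucc) := by
      rw [← hIio, Finset.Iio_insert]
    have hnot : j.succ ∉ Finset.Iic j.castSucc := by rw [← hIio]; simp
    -- Taylor expansion φ(x + l) = φ + lφ' + (l²/2)φ'' on an interval without masses.
    have hv : S.waveValue z j.succ = S.waveValue z j.castSucc +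
        l * (-(2 * z) * ∑ i ∈ Finset.Iic j.castSucc, S.mass i * S.waveValue z i *
          (S.pos j.castSucc - S.pos i)) +
        l ^ 2 / 2 * (-(2 * z) * ∑ i ∈ Finset.Iic j.castSucc, S.mass i * S.waveValue z i) := by
      have e : S.waveValue z j.castSucc = 1 - z * ∑ i ∈ Finset.Iic j.castSucc,
          S.mass i * S.waveValue z i * (S.pos j.castSucc - S.pos i) ^ 2 := by
        rw [S.waveValue_eq, ← Finset.Iio_insert, Finset.sum_insert (by simp)]
        simp
      have e2 : ∑ i ∈ Finset.Iic j.castSucc, (S.mass i : ℂ) * S.waveValue z i *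
          (S.pos j.succ - S.pos i) ^ 2 = ∑ i ∈ Finset.Iic j.castSucc, (S.mass i : ℂ) *
          S.waveValue z i * (S.pos j.castSucc - S.pos i) ^ 2 +
          (2 * l * ∑ i ∈ Finset.Iic j.castSucc, (S.mass i : ℂ) * S.waveValue z i *
            (S.pos j.castSucc - S.pos i) +
          l ^ 2 * ∑ i ∈ Finset.Iic j.castSucc, (S.mass i : ℂ) * S.waveValue z i) := by
        simp only [Finset.mul_sum, ← Finset.sum_add_distrib, hpos]
        refine Finset.sum_congr rfl fun i _ => ?_
        push_cast
        ring
      rw [e, S.waveValue_eq, hIio, e2]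
      ring
    have hv' : S.waveValue z j.succ =
        targetA ev M z * stateC ev b M z (peelFormula ev b M k).2.2 := by
      rw [hv, h1, h2, h3]
      linear_combination targetA ev M z * hC + l * targetA ev M z * hB
    refine ⟨hv', ?_, ?_⟩
    · rw [hIic, Finset.sum_insert hnot, hm, hv']
      linear_combination h2 + targetA ev M z * hA
    · rw [hIic, Finset.sum_insert hnot, sub_self, mul_zero, zero_add]
      have e : ∑ i ∈ Finset.Iic j.castSucc, (S.mass i : ℂ) * S.waveValue z i *
          (S.pos j.succ - S.pos i) = ∑ i ∈ Finset.Iic j.castSucc, (S.mass i : ℂ) *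
          S.waveValue z i * (S.pos j.castSucc - S.pos i) +
          l * ∑ i ∈ Finset.Iic j.castSucc, (S.mass i : ℂ) * S.waveValue z i := by
        rw [Finset.mul_sum, ← Finset.sum_add_distrib, hpos]
        refine Finset.sum_congr rfl fun i _ => ?_
        push_cast
        ring
      rw [e]
      linear_combination h3 + l * h2 + targetA ev M z * hB

theorem waveEnd_and_weyl {S : DiscreteCubicString (N + 1)} (hS : IsGivenByFormulas S ev b M)
    {z : ℂ} (hz : z ≠ 0) (hz' : ∀ k, z ≠ ev k) :
    -2 * S.waveEnd z = targetA ev M z ∧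
    -(2 * z) * ∑ i, S.mass i * S.waveValue z i * (S.pos (Fin.last N) - S.pos i) =
      targetA ev M z * ∑ k, (b k : ℂ) / (z - ev k) := by
  obtain ⟨-, h2, h3⟩ := wave_state hev hinj hb hM hS hz hz' (Fin.last N) 0 (by simp)
  have hI : Finset.Iic (Fin.last N) = Finset.univ := by ext i; simp [Fin.le_last]
  have hz0 : ∀ p, cauchyTransform ev b 0 p = 0 := fun p => by simp [cauchyTransform]
  rw [hI] at h2 h3
  constructor
  · rw [DiscreteCubicString.waveEnd]
    have : stateA ev b M z (peelFormula ev b M 0).1 = 1 := by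
      simp [peelFormula, peel, stateA, hz0]
    rw [this] at h2
    linear_combination h2
  · rw [h3]
    simp [peelFormula, peel, stateB, hz0]

/-- Both sides are continuous in z and agree off a finite set. The excluded points 0 and λ_k, where
the candidate functions may have poles, are exactly the eigenvalues to be detected. -/
theorem waveEnd_eq {S : DiscreteCubicString (N + 1)} (hS : IsGivenByFormulas S ev b M) (z : ℂ) :
    -2 * S.waveEnd z = targetA ev M z := by
  have hfin : (insert 0 (Set.range fun k => (ev k : ℂ))).Finite := (Set.finite_range _).insert 0
  have hdense : Dense (Set.univ \ insert 0 (Set.range fun k => (ev k : ℂ))) :=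
    dense_univ.sdiff_finite hfin
  have hc1 : Continuous fun z => -2 * S.waveEnd z := continuous_const.mul S.continuous_waveEnd
  have hc2 : Continuous (targetA ev M) := by unfold targetA; fun_prop
  refine congrFun (hc1.ext_on hdense hc2 fun z hz => ?_) z
  have hz2 : ¬ (z = 0 ∨ ∃ k, (ev k : ℂ) = z) := hz.2
  push Not at hz2
  exact (waveEnd_and_weyl hev hinj hb hM hS hz2.1 fun k => (hz2.2 k).symm).1

theorem eval_zero_peelFormula {k : ℕ} (hk : k ≤ N + 1) :
    (peelFormula ev b M k).1.eval 0 = -(2 * ∑ i ∈ Finset.range k, massFormula ev b M i) := by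
  induction k with
  | zero => simp [peelFormula, peel]
  | succ k ih =>
    have h1 := (peelInvariant_peelFormula hev hinj hb hM (show k ≤ N by omega)).R_zero
    have h2 : (peelFormula ev b M (k + 1)).1 = (peelFormula ev b M k).1 +
      (-(2 * massFormula ev b M k)) • (peelFormula ev b M k).2.2 := rfl
    rw [h2, eval_add, eval_smul, h1, ih (by omega), Finset.sum_range_succ, smul_eq_mul]
    ring

theorem hasSpectralData {S : DiscreteCubicString (N + 1)} (hS : IsGivenByFormulas S ev b M) :
    S.HasSpectralData ev b M where
  eigenvalues z := by
    rw [S.isEigenvalue_iff, ← targetA_eq_zero_iff hev hM z,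
      ← waveEnd_eq hev hinj hb hM hS z]
    simp
  weyl z hz hz' := by
    obtain ⟨h1, h2⟩ := waveEnd_and_weyl hev hinj hb hM hS hz hz'
    have hT : targetA ev M z ≠ 0 := fun h => by
      rcases (targetA_eq_zero_iff hev hM z).1 h with h | ⟨k, h⟩
      · exact hz h
      · exact hz' k h
    have h0 : S.waveEnd z ≠ 0 := fun h => by rw [h, mul_zero] at h1; exact hT h1.symm
    have := S.hasWeylValue h0
    rwa [h1, h2, mul_div_cancel_left₀ _ hT] at this
  total_mass := by
    -- q_{N+1}(0) is -2M by orthogonality and minus twice the sum of the masses by the recursion.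
    have h1 := eval_zero_of_orth hev hM (q_succ_peelFormula hev hinj hb hM le_rfl)
    rw [eval_zero_peelFormula hev hinj hb hM le_rfl] at h1
    have h2 : ∑ k, S.mass k = ∑ i ∈ Finset.range (N + 1), massFormula ev b M i := by
      rw [← Finset.sum_range_reflect, Finset.sum_range]
      refine Finset.sum_congr rfl fun j _ => ?_
      rw [hS.1 j]
      congr 1
    rw [h2]
    linarith

theorem massFormula_pos {k : ℕ} (hk : k ≤ N) : 0 < massFormula ev b M k :=
  ((peelInvariant_peelFormula hev hinj hb hM hk).two_mul_massFormula hev hinj hb hM hk).1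

theorem exists_isGivenByFormulas :
    ∃ S : DiscreteCubicString (N + 1), IsGivenByFormulas S ev b M := by
  have hsucc : ∀ j : Fin N, ∑ i ∈ Finset.range (j.succ : Fin (N + 1)), lengthFormula ev b M (N - i) =
      ∑ i ∈ Finset.range (j.castSucc : Fin (N + 1)), lengthFormula ev b M (N - i) +
        lengthFormula ev b M (N - j) := fun j => by
    rw [Fin.val_succ, Finset.sum_range_succ]; rfl
  -- The translation is fixed by placing the first mass at 0.
  refine ⟨⟨fun j => ∑ i ∈ Finset.range j, lengthFormula ev b M (N - i),
    fun j => massFormula ev b M (N - j), Fin.strictMono_iff_lt_succ.2 fun j => ?_,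
    fun j => massFormula_pos hev hinj hb hM (by omega)⟩, fun j => rfl, fun j => ?_⟩
  · rw [hsucc, lt_add_iff_pos_right, show N - (j : ℕ) = N - j - 1 + 1 by omega]
    exact lengthFormula_pos hev hinj hb hM (by omega)
  · simp only [hsucc, add_sub_cancel_left]

end CubicStringInverse

end

theorem mainTheorem2 (N : ℕ) (ev b : Fin N → ℝ) (M : ℝ)
    (hev_pos : ∀ k, 0 < ev k) (hev_mono : StrictMono ev)
    (hb : ∀ k, b k < 0) (hM : 0 < M) :
    (∀ k : ℕ, k ≤ N → 0 < CubicStringInverse.massFormula ev b M k) ∧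
    (∀ k : ℕ, 1 ≤ k → k ≤ N → 0 < CubicStringInverse.lengthFormula ev b M k) ∧
    (∃ S : DiscreteCubicString (N + 1), CubicStringInverse.IsGivenByFormulas S ev b M) ∧
    (∀ S : DiscreteCubicString (N + 1), CubicStringInverse.IsGivenByFormulas S ev b M →
      S.HasSpectralData ev b M) := by
  refine ⟨fun k hk => CubicStringInverse.massFormula_pos hev_pos hev_mono.injective hb hM hk,
    fun k hk1 hk => ?_,
    CubicStringInverse.exists_isGivenByFormulas hev_pos hev_mono.injective hb hM,
    fun S hS => CubicStringInverse.hasSpectralData hev_pos hev_mono.injective hb hM hS⟩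
  obtain ⟨k, rfl⟩ : ∃ k', k = k' + 1 := ⟨k - 1, by omega⟩
  exact CubicStringInverse.lengthFormula_pos hev_pos hev_mono.injective hb hM hk
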